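/- Let $N\ge 2$ and $\vec\kappa=(\kappa_0,\kappa_1,\kappa_\infty,\theta_1,\dots,\theta_N)\in\mathbb C^{N+3}$, and put $\alpha=-\frac12(\kappa_0+\kappa_1+\kappa_\infty+\sum_i\theta_i-1)$, $R_{ij}=\frac{s_i(s_j-1)}{s_j-s_i}$, $S_{ij}=\frac{s_i(s_i-1)}{s_i-s_j}$. The Garnier system with parameter $\vec\kappa$ is $\partial q_i/\partial s_j=\partial H_j/\partial p_i$, $\partial p_i/\partial s_j=-\partial H_j/\partial q_i$ $(1\le i,j\le N)$, where $H_i=H_i(q,p,s;\vec\kappa)$ is given by $$\begin{aligned}s_i(s_i-1)H_i={}&q_i\Big(\alpha+\sum_j q_jp_j\Big)\Big(\alpha+\kappa_\infty+\sum_j q_jp_j\Big)+s_ip_i(q_ip_i-\theta_i)\\&-\sum_{j\ne i}R_{ji}(q_jp_j-\theta_j)q_ip_j-\sum_{j\ne i}S_{ij}(q_ip_i-\theta_i)q_jp_i-\sum_{j\ne i}R_{ij}q_jp_j(q_ip_i-\theta_i)\\&-\sum_{j\ne i}R_{ij}q_ip_i(q_jp_j-\theta_j)-(s_i+1)(q_ip_i-\theta_i)q_ip_i+(\kappa_1s_i+\kappa_0-1)q_ip_i.\end{aligned}$$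 Consider the following birational transformations of $(q,p,\vec\kappa)$ (over fixed $s$; quantities not mentioned are unchanged): - $R_{\kappa_\infty}$: $\kappa_\infty\mapsto-\kappa_\infty$; - $R_{\kappa_1}$: $\kappa_1\mapsto-\kappa_1$, $p_i\mapsto p_i-\kappa_1/(\sum_jq_j-1)$ for all $i$; - $R_{\kappa_0}$: $\kappa_0\mapsto-\kappa_0$, $p_i\mapsto p_i-\kappa_0/\big(s_i(\sum_jq_j/s_j-1)\big)$ for all $i$; - $R_{\theta_j}$: $\theta_j\mapsto-\theta_j$, $p_j\mapsto p_j-\theta_j/q_j$; - $R_\tau$: $\vec\kappa\mapsto(1-\kappa_0,1-\kappa_1,-\kappa_\infty,-\theta_1,\dots,-\theta_N)$, $(q,p)\mapsto(Q,P)$ with $Q_i=\dfrac{s_ip_i(q_ip_i-\theta_i)}{(\alpha+\sum_jq_jp_j)(\alpha+\kappa_\infty+\sum_jq_jp_j)}$ and $Q_iP_i=-q_ip_i$, that is, $P_i=-\dfrac{q_i(\alpha+\sum_jq_jp_j)(\alpha+\kappa_\infty+\sum_jq_jp_j)}{s_i(q_ip_i-\theta_i)}$. They are involutions. Let $l=R_{\kappa_1}\circ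 R_\tau\circ R_{\theta_1}\circ\cdots\circ R_{\theta_N}\circ R_{\kappa_\infty}\circ R_{\kappa_0}$ (rightmost factor first), so that $l(\vec\kappa)=\vec\kappa+(1,-1,0,\dots,0)$. For $n\in\mathbb Z$, $l^n$ is regarded as defined at a point if none of the displayed denominators vanishes in any of its successive factors. Let $D$ be an open subset of $\{s\in\mathbb C^N: s_i\ne0,1,\ s_i\ne s_j\ (i\ne j)\}$ and $(q,p)$ a holomorphic solution on $D$ of the Garnier system with parameter $\vec\kappa$. For $n\in\mathbb Z$ let $W_n\subseteq D$ be open sets such that $l^n$ is defined at $(q(s),p(s),\vec\kappa)$ for all $s\in W_n$ and such that every intersection $W_{n-1}\cap W_n\cap W_{n+1}$ is connected (or empty), and let $l^n(\tau)$ be a $\tau$-function on $W_n$: a nowhere vanishing holomorphic function with $d\log l^n(\tau)=\sum_i l^n(H_i)\,ds_i$, where $l^n(H_i)$ is $H_i$ evaluated at $l^n(q(s),p(s),\vec\kappa)$ and $s$. Introduce the variables $\xi_i$ by $s_i=\xi_i/(\xi_i-1)$ (equivalently $\xi_i=s_i/(s_i-1)$), and put $A=\sum_i\xi_i\frac{\partial}{\partial\xi_i}$,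 $B=\sum_i\frac{\partial}{\partial\xi_i}$, $\Delta=\prod_{i>j}(\xi_i-\xi_j)$, $\psi=\Delta^{2/(N(N-1))}$, where $\psi$ and its powers are formed with a fixed holomorphic branch of $\log\Delta$ on the set of $\xi$ corresponding to $D$. Let $$X=\psi(A-B),\quad Y=\psi A,\quad a_n=-(\kappa_1-n)(\kappa_0+n-1)+\alpha(\alpha+\kappa_\infty),\quad \tau_n=\psi^{a_n}\,l^n(\tau).$$ Then $[X,Y]=0$, and there are nonzero constants $c_n\in\mathbb C$ $(n\in\mathbb Z)$ such that for every $n\in\mathbb Z$ the Toda equation $$XY\log\tau_n=c_n\,\frac{\tau_{n-1}\tau_{n+1}}{\tau_n^2}$$ holds at all $\xi$ corresponding to points of $W_{n-1}\cap W_n\cap W_{n+1}$. -/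

import Mathlib

namespace Garnier

/-- The parameters `(κ₀, κ₁, κ_∞, θ₁, …, θ_N)` of the Garnier system. -/
@[ext]
structure Params (N : ℕ) where
  k0 : ℂ
  k1 : ℂ
  kinf : ℂ
  th : Fin N → ℂ

/-- `α = -(κ₀ + κ₁ + κ_∞ + ∑ θ_i - 1)/2`. -/
noncomputable def Params.alpha {N : ℕ} (k : Params N) : ℂ :=
  -(1 / 2) * (k.k0 + k.k1 + k.kinf + ∑ i, k.th i - 1)

/-- The complement of the singular locus: all `s_i` are different from `0` and `1`, and they are
pairwise distinct. -/
def config (N : ℕ) : Set (Fin N → ℂ) :=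
  {s | (∀ i, s i ≠ 0 ∧ s i ≠ 1) ∧ ∀ i j, i ≠ j → s i ≠ s j}

/-- `R_{ij} = s_i (s_j - 1) / (s_j - s_i)`. -/
noncomputable def coeffR {N : ℕ} (s : Fin N → ℂ) (i j : Fin N) : ℂ :=
  s i * (s j - 1) / (s j - s i)

/-- `S_{ij} = s_i (s_i - 1) / (s_i - s_j)`. -/
noncomputable def coeffS {N : ℕ} (s : Fin N → ℂ) (i j : Fin N) : ℂ :=
  s i * (s i - 1) / (s i - s j)

/-- The Hamiltonian `H_i = H_i(q, p, s; κ)` of the Garnier system. -/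
noncomputable def ham {N : ℕ} (k : Params N) (i : Fin N) (q p s : Fin N → ℂ) : ℂ :=
  (q i * (k.alpha + ∑ j, q j * p j) * (k.alpha + k.kinf + ∑ j, q j * p j)
    + s i * p i * (q i * p i - k.th i)
    - (∑ j ∈ Finset.univ.erase i, coeffR s j i * (q j * p j - k.th j) * q i * p j)
    - (∑ j ∈ Finset.univ.erase i, coeffS s i j * (q i * p i - k.th i) * q j * p i)
    - (∑ j ∈ Finset.univ.erase i, coeffR s i j * q j * p j * (q i * p i - k.th i))
    - (∑ j ∈ Finset.univ.erase i, coeffR s i j * q i * p i * (q j * p j - k.th j))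
    - (s i + 1) * (q i * p i - k.th i) * q i * p i
    + (k.k1 * s i + k.k0 - 1) * q i * p i) / (s i * (s i - 1))

/-- The partial derivative `∂f/∂x_i`. -/
noncomputable def pd {N : ℕ} (i : Fin N) (f : (Fin N → ℂ) → ℂ) (x : Fin N → ℂ) : ℂ :=
  fderiv ℂ f x (Pi.single i 1)

/-- `(q, p)` is a holomorphic solution on `D` of the Garnier system
`∂q_i/∂s_j = ∂H_j/∂p_i`, `∂p_i/∂s_j = -∂H_j/∂q_i` with parameters `k`. -/
structure IsSolution {N : ℕ} (k : Params N) (D : Set (Fin N → ℂ))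
    (q p : (Fin N → ℂ) → Fin N → ℂ) : Prop where
  diff_q : DifferentiableOn ℂ q D
  diff_p : DifferentiableOn ℂ p D
  eq_q : ∀ s ∈ D, ∀ i j, pd j (fun t => q t i) s = pd i (fun y => ham k j (q s) y s) (p s)
  eq_p : ∀ s ∈ D, ∀ i j, pd j (fun t => p t i) s = -pd i (fun x => ham k j x (p s) s) (q s)

/-- A point `(q, p, κ)` on which the birational transformations act (over a fixed `s`). -/
@[ext]
structure State (N : ℕ) where
  par : Params N
  q : Fin N → ℂ
  p : Fin N → ℂ

/-! The birational transformations used below, as partial functions of `(q, p, κ)`, defined where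
the denominators of their formulas do not vanish. -/

/-- `R_{κ_∞}`. -/
def Rkinf {N : ℕ} : State N →. State N := fun x =>
  Part.some ⟨{ x.par with kinf := -x.par.kinf }, x.q, x.p⟩

/-- `R_{κ₁}`, with `g₁ = ∑ q_j`. -/
noncomputable def Rk1 {N : ℕ} : State N →. State N := fun x =>
  ⟨∑ j, x.q j - 1 ≠ 0, fun _ =>
    ⟨{ x.par with k1 := -x.par.k1 }, x.q,
      fun i => x.p i - x.par.k1 / (∑ j, x.q j - 1)⟩⟩

/-- `R_{κ₀}`, with `g_s = ∑ q_j / s_j`. -/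
noncomputable def Rk0 {N : ℕ} (s : Fin N → ℂ) : State N →. State N := fun x =>
  ⟨(∀ i, s i ≠ 0) ∧ ∑ j, x.q j / s j - 1 ≠ 0, fun _ =>
    ⟨{ x.par with k0 := -x.par.k0 }, x.q,
      fun i => x.p i - x.par.k0 / (s i * (∑ j, x.q j / s j - 1))⟩⟩

/-- `R_{θ_j}`. -/
noncomputable def Rth {N : ℕ} (j : Fin N) : State N →. State N := fun x =>
  ⟨x.q j ≠ 0, fun _ =>
    ⟨{ x.par with th := Function.update x.par.th j (-x.par.th j) }, x.q,
      Function.update x.p j (x.p j - x.par.th j / x.q j)⟩⟩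

/-- `(α + ∑ q_j p_j)(α + κ_∞ + ∑ q_j p_j)`. -/
noncomputable def State.E {N : ℕ} (x : State N) : ℂ :=
  (x.par.alpha + ∑ j, x.q j * x.p j) * (x.par.alpha + x.par.kinf + ∑ j, x.q j * x.p j)

/-- `R_τ`: `Q_i = s_i p_i (q_i p_i - θ_i) / E` and `Q_i P_i = - q_i p_i`, that is,
`P_i = - q_i E / (s_i (q_i p_i - θ_i))`. -/
noncomputable def Rtau {N : ℕ} (s : Fin N → ℂ) : State N →. State N := fun x =>
  ⟨x.E ≠ 0 ∧ ∀ i, s i ≠ 0 ∧ x.q i * x.p i - x.par.th i ≠ 0, fun _ =>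
    ⟨⟨-x.par.k0 + 1, -x.par.k1 + 1, -x.par.kinf, fun i => -x.par.th i⟩,
      fun i => s i * x.p i * (x.q i * x.p i - x.par.th i) / x.E,
      fun i => -(x.q i * x.E) / (s i * (x.q i * x.p i - x.par.th i))⟩⟩

/-- `R_{θ_1} ∘ ⋯ ∘ R_{θ_N}`. -/
noncomputable def RthAll (N : ℕ) : State N →. State N :=
  ((List.finRange N).map Rth).foldr PFun.comp (PFun.id _)

/-- `R_{θ_N} ∘ ⋯ ∘ R_{θ_1}`. -/
noncomputable def RthAllRev (N : ℕ) : State N →. State N :=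
  ((List.finRange N).reverse.map Rth).foldr PFun.comp (PFun.id _)

/-- `l = R_{κ₁} ∘ R_τ ∘ R_{θ_1} ∘ ⋯ ∘ R_{θ_N} ∘ R_{κ_∞} ∘ R_{κ₀}` (the rightmost factor acts
first). -/
noncomputable def l {N : ℕ} (s : Fin N → ℂ) : State N →. State N :=
  Rk1.comp ((Rtau s).comp ((RthAll N).comp (Rkinf.comp (Rk0 s))))

/-- The inverse of `l`; all the factors of `l` are involutions, see `mem_l_iff`. -/
noncomputable def lInv {N : ℕ} (s : Fin N → ℂ) : State N →. State N :=
  (Rk0 s).comp (Rkinf.comp ((RthAllRev N).comp ((Rtau s).comp Rk1)))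

/-- The `n`-fold composition of a partial function with itself. -/
def pIter {X : Type} (f : X →. X) : ℕ → (X →. X)
  | 0 => PFun.id X
  | n + 1 => f.comp (pIter f n)

/-- `l^n` for `n ∈ ℤ`. -/
noncomputable def lPow {N : ℕ} (s : Fin N → ℂ) : ℤ → (State N →. State N)
  | Int.ofNat n => pIter (l s) n
  | Int.negSucc n => pIter (lInv s) (n + 1)

theorem mem_comp_iff {X Y Z : Type} (f : Y →. Z) (g : X →. Y) (x : X) (z : Z) :
    z ∈ f.comp g x ↔ ∃ y ∈ g x, z ∈ f y := by
  rw [PFun.comp_apply]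
  exact Part.mem_bind_iff

theorem Rkinf_symm {N : ℕ} {x y : State N} (h : y ∈ Rkinf x) : x ∈ Rkinf y := by
  simp only [Rkinf, Part.mem_some_iff] at h ⊢
  subst h
  simp

theorem Rk1_symm {N : ℕ} {x y : State N} (h : y ∈ Rk1 x) : x ∈ Rk1 y := by
  obtain ⟨h1, rfl⟩ := h
  refine ⟨h1, ?_⟩
  ext <;> simp [Rk1, neg_div]

theorem Rk0_symm {N : ℕ} {s : Fin N → ℂ} {x y : State N} (h : y ∈ Rk0 s x) : x ∈ Rk0 s y := by
  obtain ⟨h1, rfl⟩ := h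
  refine ⟨h1, ?_⟩
  ext <;> simp [Rk0, neg_div]

theorem Rth_symm {N : ℕ} {j : Fin N} {x y : State N} (h : y ∈ Rth j x) : x ∈ Rth j y := by
  obtain ⟨h1, rfl⟩ := h
  refine ⟨h1, ?_⟩
  ext i
  · rfl
  · rfl
  · rfl
  · simp [Rth]
  · rfl
  · by_cases hi : i = j
    · subst hi; simp [Rth, neg_div]
    · simp [Rth, hi]

theorem Rtau_symm {N : ℕ} {s : Fin N → ℂ} {x y : State N} (h : y ∈ Rtau s x) :
    x ∈ Rtau s y := by
  obtain ⟨⟨hE, hi⟩, rfl⟩ := h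
  set y := (Rtau s x).get ⟨hE, hi⟩ with hy
  have hq : ∀ i, y.q i = s i * x.p i * (x.q i * x.p i - x.par.th i) / x.E := fun _ => rfl
  have hp : ∀ i, y.p i = -(x.q i * x.E) / (s i * (x.q i * x.p i - x.par.th i)) := fun _ => rfl
  have hth : ∀ i, y.par.th i = -x.par.th i := fun _ => rfl
  have hqp : ∀ i, y.q i * y.p i = -(x.q i * x.p i) := by
    intro i
    have h1 := (hi i).1
    have h2 := (hi i).2
    rw [hq, hp, div_mul_div_comm, div_eq_iff (mul_ne_zero hE (mul_ne_zero h1 h2))]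
    ring
  have hal : y.par.alpha = -x.par.alpha := by
    simp only [Params.alpha, hy, Rtau, Finset.sum_neg_distrib]
    ring
  have hki : y.par.kinf = -x.par.kinf := rfl
  have hEE : y.E = x.E := by
    simp only [State.E, hqp, hal, hki, Finset.sum_neg_distrib]
    ring
  have hd : ∀ i, y.q i * y.p i - y.par.th i = -(x.q i * x.p i - x.par.th i) := by
    intro i; rw [hqp, hth]; ring
  refine ⟨⟨by rwa [hEE], fun i => ⟨(hi i).1, by rw [hd]; exact neg_ne_zero.2 (hi i).2⟩⟩, ?_⟩
  ext i
  · simp [Rtau, hy]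
  · simp [Rtau, hy]
  · simp [Rtau, hy]
  · simp [Rtau, hy]
  · have h1 := (hi i).1
    have h2 := (hi i).2
    change s i * y.p i * (y.q i * y.p i - y.par.th i) / y.E = _
    rw [hd, hEE, hp]
    field_simp
  · have h1 := (hi i).1
    have h2 := (hi i).2
    change -(y.q i * y.E) / (s i * (y.q i * y.p i - y.par.th i)) = _
    rw [hd, hEE, hq, div_mul_cancel₀ _ hE, div_eq_iff (mul_ne_zero h1 (neg_ne_zero.2 h2))]
    ring

theorem foldr_comp_append {X : Type} (L M : List (X →. X)) :
    (L ++ M).foldr PFun.comp (PFun.id _)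
      = (L.foldr PFun.comp (PFun.id _)).comp (M.foldr PFun.comp (PFun.id _)) := by
  induction L with
  | nil => simp
  | cons a L ih => simp [ih, PFun.comp_assoc]

theorem mem_foldr_reverse {N : ℕ} (L : List (Fin N)) {x y : State N}
    (h : y ∈ (L.map Rth).foldr PFun.comp (PFun.id _) x) :
    x ∈ (L.reverse.map Rth).foldr PFun.comp (PFun.id _) y := by
  induction L generalizing y with
  | nil => simpa [eq_comm] using h
  | cons a L ih =>
    simp only [List.map_cons, List.foldr_cons, mem_comp_iff] at h
    obtain ⟨z, hz, hyz⟩ := h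
    rw [List.reverse_cons, List.map_append, foldr_comp_append, mem_comp_iff]
    refine ⟨z, ?_, ih hz⟩
    simp only [List.map_cons, List.map_nil, List.foldr_cons, List.foldr_nil, PFun.comp_id]
    exact Rth_symm hyz

/-- `lInv` is the inverse of `l`. -/
theorem mem_l_iff {N : ℕ} {s : Fin N → ℂ} {x y : State N} : y ∈ l s x ↔ x ∈ lInv s y := by
  simp only [l, lInv, mem_comp_iff]
  constructor
  · rintro ⟨d, ⟨c, ⟨b, ⟨a, ha, hb⟩, hc⟩, hd⟩, hy⟩
    exact ⟨a, ⟨b, ⟨c, ⟨d, Rk1_symm hy, Rtau_symm hd⟩, mem_foldr_reverse _ hc⟩, Rkinf_symm hb⟩,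
      Rk0_symm ha⟩
  · rintro ⟨a, ⟨b, ⟨c, ⟨d, hy, hd⟩, hc⟩, hb⟩, ha⟩
    refine ⟨d, ⟨c, ⟨b, ⟨a, Rk0_symm ha, Rkinf_symm hb⟩, ?_⟩, Rtau_symm hd⟩, Rk1_symm hy⟩
    simpa [RthAll] using mem_foldr_reverse _ hc

theorem par_of_mem_foldr {N : ℕ} (L : List (Fin N)) (hL : L.Nodup) {x y : State N}
    (h : y ∈ (L.map Rth).foldr PFun.comp (PFun.id _) x) :
    y.par = { x.par with th := fun i => if i ∈ L then -x.par.th i else x.par.th i } := by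
  induction L generalizing y with
  | nil =>
    have h' : y = x := by simpa using h
    simp [h']
  | cons a L ih =>
    simp only [List.map_cons, List.foldr_cons, mem_comp_iff] at h
    obtain ⟨z, hz, ⟨h1, rfl⟩⟩ := h
    have hn := List.nodup_cons.1 hL
    have hz' := ih hn.2 hz
    change ({ z.par with th := Function.update z.par.th a (-z.par.th a) } : Params N) = _
    rw [hz']
    ext i
    · rfl
    · rfl
    · rfl
    · by_cases hi : i = a
      · subst hi; simp [hn.1]
      · simp [hi]

/-- `l` acts on the parameters as the translation by `(1, -1, 0, …, 0)`. -/
theorem par_of_mem_l {N : ℕ} {s : Fin N → ℂ} {x y : State N} (h : y ∈ l s x) :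
    y.par = { x.par with k0 := x.par.k0 + 1, k1 := x.par.k1 - 1 } := by
  simp only [l, mem_comp_iff] at h
  obtain ⟨d, ⟨c, ⟨b, ⟨a, ⟨_, rfl⟩, hb⟩, hc⟩, ⟨_, rfl⟩⟩, ⟨_, rfl⟩⟩ := h
  have hc' := par_of_mem_foldr _ (List.nodup_finRange N) hc
  have hb' := Part.mem_some_iff.1 hb
  subst hb'
  ext i
  · simp [Rk1, Rtau, hc', Rk0]
  · simp [Rk1, Rtau, hc', Rk0]; ring
  · simp [Rk1, Rtau, hc', Rk0]
  · simp [Rk1, Rtau, hc', Rk0]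

/-- `tau` is the `τ`-function `l^n(τ)` on `W`: a nowhere vanishing holomorphic function such that
`l^n` is defined at `(q(s), p(s), κ)` for all `s ∈ W` and `d log (tau) = ∑ l^n(H_i) ds_i`, where
`l^n(H_i)` is the Hamiltonian at the transformed point and the transformed parameters. -/
structure IsTau {N : ℕ} (k : Params N) (q p : (Fin N → ℂ) → Fin N → ℂ) (n : ℤ)
    (W : Set (Fin N → ℂ)) (tau : (Fin N → ℂ) → ℂ) : Prop where
  diff : DifferentiableOn ℂ tau W
  ne_zero : ∀ s ∈ W, tau s ≠ 0
  dlog : ∀ s ∈ W, ∃ y ∈ lPow s n ⟨k, q s, p s⟩,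
    ∀ i, pd i tau s / tau s = ham y.par i y.q y.p s

/-- The change of variables `s_i = ξ_i / (ξ_i - 1)`. -/
noncomputable def sOf {N : ℕ} (xi : Fin N → ℂ) : Fin N → ℂ := fun i => xi i / (xi i - 1)

/-- The difference product `Δ = ∏_{i > j} (ξ_i - ξ_j)`. -/
noncomputable def Delta {N : ℕ} (xi : Fin N → ℂ) : ℂ :=
  ∏ i, ∏ j ∈ Finset.Iio i, (xi i - xi j)

/-- `logDelta` is a holomorphic branch of `log Δ` on the set `O`. -/
structure IsLogDelta {N : ℕ} (O : Set (Fin N → ℂ)) (logDelta : (Fin N → ℂ) → ℂ) : Prop where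
  diff : DifferentiableOn ℂ logDelta O
  exp_eq : ∀ xi ∈ O, Complex.exp (logDelta xi) = Delta xi

/-- `ψ^a` with `ψ = Δ^{2/(N(N-1))}`, for the given branch of `log Δ`. -/
noncomputable def psiPow {N : ℕ} (logDelta : (Fin N → ℂ) → ℂ) (a : ℂ) (xi : Fin N → ℂ) : ℂ :=
  Complex.exp (a * (2 / ((N : ℂ) * ((N : ℂ) - 1)) * logDelta xi))

/-- `ψ = Δ^{2/(N(N-1))}`. -/
noncomputable def psi {N : ℕ} (logDelta : (Fin N → ℂ) → ℂ) (xi : Fin N → ℂ) : ℂ :=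
  psiPow logDelta 1 xi

/-- The vector field `A = ∑ ξ_i ∂/∂ξ_i`. -/
def vecA {N : ℕ} (xi : Fin N → ℂ) : Fin N → ℂ := xi

/-- The vector field `B = ∑ ∂/∂ξ_i`. -/
def vecB {N : ℕ} (_ : Fin N → ℂ) : Fin N → ℂ := fun _ => 1

/-- The vector field `X = ψ (A - B)`. -/
noncomputable def vecX {N : ℕ} (logDelta : (Fin N → ℂ) → ℂ) (xi : Fin N → ℂ) : Fin N → ℂ :=
  psi logDelta xi • (vecA xi - vecB xi)

/-- The vector field `Y = ψ A`. -/
noncomputable def vecY {N : ℕ} (logDelta : (Fin N → ℂ) → ℂ) (xi : Fin N → ℂ) : Fin N → ℂ :=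
  psi logDelta xi • vecA xi

/-- The derivative `V f` of a function `f` along a vector field `V`. -/
noncomputable def along {N : ℕ} (V : (Fin N → ℂ) → Fin N → ℂ) (f : (Fin N → ℂ) → ℂ)
    (xi : Fin N → ℂ) : ℂ :=
  fderiv ℂ f xi (V xi)

/-- The derivative `V log f = (V f) / f` of any local branch of `log f` along `V`, for a nowhere
vanishing `f`. -/
noncomputable def alongLog {N : ℕ} (V : (Fin N → ℂ) → Fin N → ℂ) (f : (Fin N → ℂ) → ℂ)
    (xi : Fin N → ℂ) : ℂ :=
  along V f xi / f xi

/-- `a_n = -(κ₁ - n)(κ₀ + n - 1) + α(α + κ_∞)`. -/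
noncomputable def expo {N : ℕ} (k : Params N) (n : ℤ) : ℂ :=
  -(k.k1 - n) * (k.k0 + n - 1) + k.alpha * (k.alpha + k.kinf)

/-- `τ_n = ψ^{a_n} l^n(τ)` as a function of `ξ`, where `ltau n` is `l^n(τ)` as a function of `s`. -/
noncomputable def tauSeq {N : ℕ} (k : Params N) (logDelta : (Fin N → ℂ) → ℂ)
    (ltau : ℤ → (Fin N → ℂ) → ℂ) (n : ℤ) (xi : Fin N → ℂ) : ℂ :=
  psiPow logDelta (expo k n) xi * ltau n (sOf xi)

end Garnier

/-! Write g = ∑ q_j, U = ∑ q_j p_j, V = ∑ p_j (q_j p_j − θ_j) and E = (α + U)(α + κ_∞ + U). The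
proof rests on the function Z = (1 − g)(E − V) − κ₁(κ₀ − 1) (`todaZ`), evaluated on the n-th
transform of the solution with its own parameters. Two descriptions of Z together give the Toda
equation.

The first is XY log τ_n = ψ² Z (`along_alongLog`). In the variables s, the fields A and A − B are −∑
s_i(s_i − 1) ∂/∂s_i and −∑ (s_i − 1) ∂/∂s_i. The corresponding sums of Hamiltonians lose their poles
along s_i = s_j (`sum_ham_A`, `sum_ham_B`) and Poisson commute (`hamBD_hamA`). Hence, when the first
sum is differentiated along the second flow, only its explicit dependence on s contributes
(`IsSolution.fderiv_hamA`). The rules Aψ = ψ and Bψ = 0 do the rest, and a_n is the constant that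
completes Z.

The second is that Z is a constant multiple of l^{n-1}(τ) l^{n+1}(τ) / l^n(τ)². Since l lowers H_i
by q_i p_i / s_i (`ham_of_mem_l`), the logarithmic derivative of that quotient is the difference of
q_i p_i / s_i between two consecutive transforms. Running l⁻¹ expresses this difference through the
current point (`todaZ_of_mem_l`). Hamilton's equations express ∂Z/∂s_i (`IsSolution.pd_todaZ`), and
the two agree with d log Z. The constant is not zero because Z is a product of quantities that must
not vanish for l⁻¹ to be defined. Finally a_{n-1} + a_{n+1} = 2 a_n + 2 accounts for the factor ψ².

Both descriptions use Hamilton's equations for the transformed solution. So each factor of l, with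
all the R_{θ_j} taken together, is shown to map solutions to solutions (`preservesSolutions_lPow`):
those that shift p have a generating function, and R_τ satisfies a symplectic identity. -/

namespace Garnier

open scoped Topology

variable {N : ℕ}

/-! ### Partial fractions of the Hamiltonians -/

/-- The residue of `H_i` along `s_i = s_j`. -/
def resid (k : Params N) (q p : Fin N → ℂ) (i j : Fin N) : ℂ :=
  (p i - p j) * (q i * (q j * p j - k.th j) - q j * (q i * p i - k.th i))

/-- `∑ q_j p_j`. -/
def sumU (q p : Fin N → ℂ) : ℂ := ∑ j, q j * p j

/-- `∑ p_j (q_j p_j - θ_j)`. -/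
def sumV (k : Params N) (q p : Fin N → ℂ) : ℂ := ∑ j, p j * (q j * p j - k.th j)

/-- `(α + ∑ q_j p_j)(α + κ_∞ + ∑ q_j p_j)`. -/
noncomputable def quadE (k : Params N) (q p : Fin N → ℂ) : ℂ :=
  (k.alpha + sumU q p) * (k.alpha + k.kinf + sumU q p)

/-- The part of `s_i (s_i - 1) H_i` that is regular along `s_i = s_j`. -/
noncomputable def regPart (k : Params N) (i : Fin N) (q p s : Fin N → ℂ) : ℂ :=
  q i * quadE k q p + s i * (p i * (q i * p i - k.th i)) + (s i - 1) * (q i * sumV k q p)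
    - s i * ((q i * p i - k.th i) * sumU q p)
    - s i * (q i * p i * (sumU q p - ∑ j, k.th j)) + (k.k1 * s i + k.k0 - 1) * (q i * p i)

theorem config.ne_zero {s : Fin N → ℂ} (hs : s ∈ config N) (i : Fin N) : s i ≠ 0 := (hs.1 i).1

theorem config.sub_one_ne_zero {s : Fin N → ℂ} (hs : s ∈ config N) (i : Fin N) : s i - 1 ≠ 0 :=
  sub_ne_zero.2 (hs.1 i).2

theorem config.sub_ne_zero {s : Fin N → ℂ} (hs : s ∈ config N) {i j : Fin N} (h : i ≠ j) :
    s i - s j ≠ 0 :=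
  _root_.sub_ne_zero.2 (hs.2 i j h)

/-- The functions e_i = q_i, h_i = 2 q_i p_i − θ_i, f_i = p_i (q_i p_i − θ_i) span a copy of sl₂
under the Poisson bracket, and the residue is the Gaudin coupling h_i h_j / 2 − e_i f_j − f_i e_j −
θ_i θ_j / 2. This explains its symmetry, its vanishing for i = j (the Casimir h² − 4ef equals θ²)
and its invariance under the diagonal sl₂. -/
theorem resid_symm (k : Params N) (q p : Fin N → ℂ) (i j : Fin N) :
    resid k q p i j = resid k q p j i := by
  simp only [resid]; ring

theorem resid_self (k : Params N) (q p : Fin N → ℂ) (i : Fin N) : resid k q p i i = 0 := by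
  simp only [resid]; ring

/-- The partial fraction expansion of `H_i`. -/
theorem ham_eq (k : Params N) (i : Fin N) (q p : Fin N → ℂ) {s : Fin N → ℂ} (hs : s ∈ config N) :
    ham k i q p s = ∑ j ∈ Finset.univ.erase i, resid k q p i j / (s i - s j)
      + regPart k i q p s / (s i * (s i - 1)) := by
  have h0 := config.ne_zero hs i
  have h1 := config.sub_one_ne_zero hs i
  have key : (∑ j ∈ Finset.univ.erase i, coeffR s j i * (q j * p j - k.th j) * q i * p j)
      + (∑ j ∈ Finset.univ.erase i, coeffS s i j * (q i * p i - k.th i) * q j * p i)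
      + (∑ j ∈ Finset.univ.erase i, coeffR s i j * q j * p j * (q i * p i - k.th i))
      + (∑ j ∈ Finset.univ.erase i, coeffR s i j * q i * p i * (q j * p j - k.th j))
      = -(s i * (s i - 1) * ∑ j ∈ Finset.univ.erase i, resid k q p i j / (s i - s j))
        - (s i - 1) * q i * (sumV k q p - p i * (q i * p i - k.th i))
        + s i * (q i * p i - k.th i) * (sumU q p - q i * p i)
        + s i * (q i * p i) * (sumU q p - ∑ j, k.th j - (q i * p i - k.th i)) := by
    have eV : ∑ j ∈ Finset.univ.erase i, p j * (q j * p j - k.th j)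
        = sumV k q p - p i * (q i * p i - k.th i) :=
      Finset.sum_erase_eq_sub (Finset.mem_univ i)
    have eU : ∑ j ∈ Finset.univ.erase i, q j * p j = sumU q p - q i * p i :=
      Finset.sum_erase_eq_sub (Finset.mem_univ i)
    have eA : ∑ j ∈ Finset.univ.erase i, (q j * p j - k.th j)
        = sumU q p - ∑ j, k.th j - (q i * p i - k.th i) := by
      rw [Finset.sum_erase_eq_sub (Finset.mem_univ i), Finset.sum_sub_distrib, sumU]
    rw [← eV, ← eU, ← eA]
    simp only [Finset.mul_sum, ← Finset.sum_add_distrib, ← Finset.sum_sub_distrib,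
      ← Finset.sum_neg_distrib]
    refine Finset.sum_congr rfl fun j hj => ?_
    have hij : s i - s j ≠ 0 := config.sub_ne_zero hs (Finset.ne_of_mem_erase hj).symm
    have hji : s j - s i ≠ 0 := config.sub_ne_zero hs (Finset.ne_of_mem_erase hj)
    -- All coefficients are affine in the single pole s_i / (s_i − s_j). The pole parts collect into
    -- the residue, the remaining parts into `regPart`.
    have e1 : coeffR s j i = (s i - 1) * (s i / (s i - s j) - 1) := by
      rw [coeffR]; field_simp; ring
    have e2 : coeffS s i j = (s i - 1) * (s i / (s i - s j)) := by rw [coeffS]; ring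
    have e3 : coeffR s i j = s i - (s i - 1) * (s i / (s i - s j)) := by
      rw [coeffR]; field_simp; ring
    rw [e1, e2, e3, resid]
    ring
  have hr : regPart k i q p s / (s i * (s i - 1)) * (s i * (s i - 1)) = regPart k i q p s :=
    div_mul_cancel₀ _ (mul_ne_zero h0 h1)
  rw [ham, div_eq_iff (mul_ne_zero h0 h1)]
  simp only [regPart, quadE, sumU] at hr key ⊢
  linear_combination -key - hr

theorem sum_univ_eq_sum_erase {f : Fin N → ℂ} {i : Fin N} (h : f i = 0) :
    ∑ j ∈ Finset.univ.erase i, f j = ∑ j, f j :=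
  Finset.sum_erase _ h

theorem sum_mul_sub_th (k : Params N) (q p : Fin N → ℂ) :
    ∑ j, (q j * p j - k.th j) = sumU q p - ∑ j, k.th j := by
  rw [Finset.sum_sub_distrib, sumU]

/-! ### The Hamiltonians under the factors of l -/

/-- The effect of `R_{κ_∞}` on the Hamiltonians. -/
theorem ham_Rkinf (k : Params N) (i : Fin N) (q p s : Fin N → ℂ) :
    ham { k with kinf := -k.kinf } i q p s = ham k i q p s := by
  have ha : ({ k with kinf := -k.kinf } : Params N).alpha = k.alpha + k.kinf := by
    simp only [Params.alpha]; ring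
  simp only [ham, ha]
  ring

/-- The effect of `R_{κ₁}` on the Hamiltonians. -/
theorem ham_Rk1 (k : Params N) (i : Fin N) (q p : Fin N → ℂ) {s : Fin N → ℂ} (hs : s ∈ config N)
    (hg : ∑ j, q j - 1 ≠ 0) :
    ham { k with k1 := -k.k1 } i q (fun j => p j - k.k1 / (∑ j, q j - 1)) s
      = ham k i q p s - k.k1 * k.th i / (s i - 1) := by
  have h0 := config.ne_zero hs i
  have h1 := config.sub_one_ne_zero hs i
  -- Eliminating κ₁ in favour of c removes the denominator ∑ q_j − 1. The shift of p is then the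
  -- same constant c for all j, which leaves the residues unchanged.
  obtain ⟨c, hc⟩ : ∃ c, c = k.k1 / (∑ j, q j - 1) := ⟨_, rfl⟩
  have hk : k.k1 = c * (∑ j, q j - 1) := by rw [hc]; field_simp
  rw [ham_eq _ _ _ _ hs, ham_eq _ _ _ _ hs, ← hc]
  have eF : ∀ j, resid { k with k1 := -k.k1 } q (fun j => p j - c) i j = resid k q p i j := by
    intro j; simp only [resid]; ring
  have eU : sumU q (fun j => p j - c) = sumU q p - c * ∑ j, q j := by
    simp only [sumU, Finset.mul_sum, ← Finset.sum_sub_distrib]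
    exact Finset.sum_congr rfl fun j _ => by ring
  have eV : sumV { k with k1 := -k.k1 } q (fun j => p j - c)
      = sumV k q p - c * (2 * sumU q p - ∑ j, k.th j) + c ^ 2 * ∑ j, q j := by
    simp only [sumV, sumU, Finset.mul_sum, ← Finset.sum_sub_distrib, ← Finset.sum_add_distrib]
    exact Finset.sum_congr rfl fun j _ => by ring
  have ha : ({ k with k1 := -k.k1 } : Params N).alpha = k.alpha + k.k1 := by
    simp only [Params.alpha]; ring
  have ha' : ∑ j, k.th j = -2 * k.alpha - k.k0 - k.k1 - k.kinf + 1 := by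
    simp only [Params.alpha]; ring
  simp only [eF, regPart, quadE, eU, eV, ha]
  rw [ha', hk]
  field_simp
  ring

/-- The effect of `R_{κ₀}` on the Hamiltonians. -/
theorem ham_Rk0 (k : Params N) (i : Fin N) (q p : Fin N → ℂ) {s : Fin N → ℂ} (hs : s ∈ config N)
    (hg : ∑ j, q j / s j - 1 ≠ 0) :
    ham { k with k0 := -k.k0 } i q (fun j => p j - k.k0 / (s j * (∑ j, q j / s j - 1))) s
      = ham k i q p s - k.k0 * q i / (s i ^ 2 * (∑ j, q j / s j - 1))
        - k.k0 * k.th i / (s i * (s i - 1)) := by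
  have h0 := config.ne_zero hs i
  have h1 := config.sub_one_ne_zero hs i
  obtain ⟨c, hc⟩ : ∃ c, c = k.k0 / (∑ j, q j / s j - 1) := ⟨_, rfl⟩
  have hk : k.k0 = c * (∑ j, q j / s j - 1) := by rw [hc]; field_simp
  have hp : (fun j => p j - k.k0 / (s j * (∑ j, q j / s j - 1))) = fun j => p j - c / s j := by
    ext j
    rw [hc, mul_comm (s j), div_div]
  have hq : k.k0 * q i / (s i ^ 2 * (∑ j, q j / s j - 1)) = c * q i / s i ^ 2 := by
    rw [hc]; field_simp
  rw [ham_eq _ _ _ _ hs, ham_eq _ _ _ _ hs, hp, hq]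
  -- The shifts c / s_j now differ, but they change each residue by a multiple of s_i − s_j, so no
  -- new pole appears. The correction vanishes at j = i and may be summed over all j.
  have eF : ∑ j ∈ Finset.univ.erase i,
        resid { k with k0 := -k.k0 } q (fun j => p j - c / s j) i j / (s i - s j)
      = ∑ j ∈ Finset.univ.erase i, resid k q p i j / (s i - s j)
        + (c * (q i / s i) * ∑ j, (2 * (q j * p j) - k.th j) / s j
          - c / s i * (2 * (q i * p i) - k.th i) * ∑ j, q j / s j
          + c ^ 2 * (q i / s i ^ 2) * ∑ j, q j / s j
          - c ^ 2 * (q i / s i) * ∑ j, q j / s j ^ 2) := by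
    rw [Finset.mul_sum, Finset.mul_sum, Finset.mul_sum, Finset.mul_sum, ← Finset.sum_sub_distrib,
      ← Finset.sum_add_distrib, ← Finset.sum_sub_distrib,
      ← sum_univ_eq_sum_erase (i := i) (by field_simp; ring), ← Finset.sum_add_distrib]
    refine Finset.sum_congr rfl fun j hj => ?_
    have hij : s i - s j ≠ 0 := config.sub_ne_zero hs (Finset.ne_of_mem_erase hj).symm
    have h0j := config.ne_zero hs j
    simp only [resid]
    field_simp
    ring
  have eU : sumU q (fun j => p j - c / s j) = sumU q p - c * ∑ j, q j / s j := by
    simp only [sumU, Finset.mul_sum, ← Finset.sum_sub_distrib]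
    exact Finset.sum_congr rfl fun j _ => by ring
  have eV : sumV { k with k0 := -k.k0 } q (fun j => p j - c / s j)
      = sumV k q p - c * ∑ j, (2 * (q j * p j) - k.th j) / s j + c ^ 2 * ∑ j, q j / s j ^ 2 := by
    simp only [sumV, Finset.mul_sum, ← Finset.sum_sub_distrib, ← Finset.sum_add_distrib]
    exact Finset.sum_congr rfl fun j _ => by ring
  have ha : ({ k with k0 := -k.k0 } : Params N).alpha = k.alpha + k.k0 := by
    simp only [Params.alpha]; ring
  have ha' : ∑ j, k.th j = -2 * k.alpha - k.k0 - k.k1 - k.kinf + 1 := by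
    simp only [Params.alpha]; ring
  rw [eF]
  simp only [regPart, quadE, eU, eV, ha]
  rw [ha', hk]
  generalize ∑ j, (2 * (q j * p j) - k.th j) / s j = S1
  generalize ∑ j, q j / s j ^ 2 = S2
  generalize ∑ j, q j / s j = S3
  field_simp
  ring

/-- The effect of `R_{θ_1} ∘ ⋯ ∘ R_{θ_N}` on the Hamiltonians. -/
theorem ham_RthAll (k : Params N) (i : Fin N) (q p : Fin N → ℂ) {s : Fin N → ℂ}
    (hs : s ∈ config N) (hq : ∀ j, q j ≠ 0) :
    ham { k with th := fun j => -k.th j } i q (fun j => p j - k.th j / q j) s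
      = ham k i q p s - k.th i * (k.k1 * s i + k.k0 - 1) / (s i * (s i - 1)) := by
  have h0 := config.ne_zero hs i
  have h1 := config.sub_one_ne_zero hs i
  -- The shift exchanges the roles of q_j p_j and q_j p_j − θ_j, while q_j and p_j (q_j p_j − θ_j)
  -- are fixed. So the sl₂ generators do not move, and since all θ_j change sign together the
  -- products θ_i θ_j do not either.
  have hu : ∀ j, q j * (p j - k.th j / q j) = q j * p j - k.th j := by
    intro j; have := hq j; field_simp
  have hv : ∀ j, (p j - k.th j / q j) * (q j * (p j - k.th j / q j) - -k.th j)
      = p j * (q j * p j - k.th j) := by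
    intro j; have := hq j; field_simp; ring
  rw [ham_eq _ _ _ _ hs, ham_eq _ _ _ _ hs]
  have eF : ∀ j, resid { k with th := fun j => -k.th j } q (fun j => p j - k.th j / q j) i j
      = resid k q p i j := by
    intro j
    have := hq i
    have := hq j
    simp only [resid, hu]
    field_simp
    ring
  have eU : sumU q (fun j => p j - k.th j / q j) = sumU q p - ∑ j, k.th j := by
    simp only [sumU, hu, Finset.sum_sub_distrib]
  have eV : sumV { k with th := fun j => -k.th j } q (fun j => p j - k.th j / q j)
      = sumV k q p := by
    simp only [sumV, hv]
  have ha : ({ k with th := fun j => -k.th j } : Params N).alpha = k.alpha + ∑ j, k.th j := by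
    simp only [Params.alpha, Finset.sum_neg_distrib]; ring
  simp only [eF, regPart, quadE, eU, eV, ha, hu, Finset.sum_neg_distrib]
  have := hq i
  field_simp
  ring

/-- The effect of `R_τ` on the Hamiltonians. -/
theorem ham_Rtau (k : Params N) (i : Fin N) (q p : Fin N → ℂ) {s : Fin N → ℂ}
    (hs : s ∈ config N) (hE : quadE k q p ≠ 0) (ha : ∀ j, q j * p j - k.th j ≠ 0) :
    ham ⟨-k.k0 + 1, -k.k1 + 1, -k.kinf, fun j => -k.th j⟩ i
        (fun j => s j * p j * (q j * p j - k.th j) / quadE k q p)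
        (fun j => -(q j * quadE k q p) / (s j * (q j * p j - k.th j))) s
      = ham k i q p s - q i * p i / s i := by
  have h0 := config.ne_zero hs
  have h1 := config.sub_one_ne_zero hs i
  rw [ham_eq _ _ _ _ hs, ham_eq _ _ _ _ hs]
  obtain ⟨E, hEd⟩ : ∃ E, E = quadE k q p := ⟨_, rfl⟩
  rw [← hEd] at hE ⊢
  set Q : Fin N → ℂ := fun j => s j * p j * (q j * p j - k.th j) / E with hQ
  set P : Fin N → ℂ := fun j => -(q j * E) / (s j * (q j * p j - k.th j)) with hP
  set k' : Params N := ⟨-k.k0 + 1, -k.k1 + 1, -k.kinf, fun j => -k.th j⟩ with hk'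
  -- R_τ negates q_j p_j and, up to the factors s_j and E, swaps q_j with p_j (q_j p_j − θ_j). The
  -- factors E cancel in each residue. The ratios s_i / s_j change it by a multiple of s_i − s_j.
  have hu : ∀ j, Q j * P j = -(q j * p j) := by
    intro j
    simp only [hQ, hP]
    rw [div_mul_div_comm, div_eq_iff (mul_ne_zero hE (mul_ne_zero (h0 j) (ha j)))]
    ring
  have hth : ∀ j, k'.th j = -k.th j := fun j => rfl
  have hPa : ∀ j, P j * (-(q j * p j) - -k.th j) = q j * E / s j := by
    intro j
    simp only [hP]
    rw [div_mul_eq_mul_div, div_eq_div_iff (mul_ne_zero (h0 j) (ha j)) (h0 j)]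
    ring
  have hQE : ∀ j, Q j * E = s j * (p j * (q j * p j - k.th j)) := by
    intro j
    simp only [hQ]; field_simp
  have eF : ∑ j ∈ Finset.univ.erase i, resid k' Q P i j / (s i - s j)
      = ∑ j ∈ Finset.univ.erase i, resid k q p i j / (s i - s j)
        + (q i / s i * sumV k q p
          - p i * (q i * p i - k.th i) * ∑ j, q j / s j) := by
    rw [sumV, Finset.mul_sum, Finset.mul_sum, ← Finset.sum_sub_distrib,
      ← sum_univ_eq_sum_erase (i := i) (by field_simp; ring), ← Finset.sum_add_distrib]
    refine Finset.sum_congr rfl fun j hj => ?_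
    have hij : s i - s j ≠ 0 := config.sub_ne_zero hs (Finset.ne_of_mem_erase hj).symm
    have h0i := h0 i
    have h0j := h0 j
    have hr : resid k' Q P i j = -(s i / s j) * (p i * (q i * p i - k.th i)) * q j
        - (s j / s i) * (p j * (q j * p j - k.th j)) * q i
        + (q i * p i - k.th i) * (q j * p j) + (q j * p j - k.th j) * (q i * p i) := by
      have e1 : Q i * (P j * (-(q j * p j) - -k.th j))
          = (s i / s j) * (p i * (q i * p i - k.th i)) * q j := by
        rw [hPa, ← mul_div_assoc, ← mul_assoc, mul_right_comm, hQE]; ring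
      have e2 : Q j * (P i * (-(q i * p i) - -k.th i))
          = (s j / s i) * (p j * (q j * p j - k.th j)) * q i := by
        rw [hPa, ← mul_div_assoc, ← mul_assoc, mul_right_comm, hQE]; ring
      have e3 : resid k' Q P i j = (Q i * P i) * (Q j * P j - k'.th j)
          + (Q j * P j) * (Q i * P i - k'.th i)
          - Q i * (P j * (Q j * P j - k'.th j)) - Q j * (P i * (Q i * P i - k'.th i)) := by
        simp only [resid]; ring
      rw [e3, hu, hu, hth, hth, e1, e2]; ring
    rw [hr, resid]
    field_simp
    ring
  have eU : sumU Q P = -sumU q p := by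
    simp only [sumU, hu, Finset.sum_neg_distrib]
  have eV : sumV k' Q P = E * ∑ j, q j / s j := by
    simp only [sumV, hu, hth, hPa, Finset.mul_sum]
    exact Finset.sum_congr rfl fun j _ => by ring
  have hal : k'.alpha = -k.alpha := by
    simp only [Params.alpha, hk', Finset.sum_neg_distrib]
    ring
  have eE : quadE k' Q P = E := by
    rw [hEd, quadE, quadE, eU, hal]; simp only [hk']; ring
  have hQi : Q i * (E * ∑ j, q j / s j)
      = s i * (p i * (q i * p i - k.th i)) * ∑ j, q j / s j := by
    rw [← mul_assoc, hQE]
  have h0i := h0 i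
  rw [eF]
  simp only [regPart, eU, eV, eE, hu, hth, hQi, hQE, hPa, ← hEd, Finset.sum_neg_distrib]
  simp only [hk']
  field_simp
  ring

/-- Each R_{θ_j} touches only p_j and θ_j, so distinct ones do not interfere and the order is
irrelevant. This treats the composite in l and the reversed one in l⁻¹ at once. -/
theorem eq_of_mem_foldr_Rth (L : List (Fin N)) (hL : L.Nodup) {x y : State N}
    (h : y ∈ (L.map Rth).foldr PFun.comp (PFun.id _) x) :
    (∀ i ∈ L, x.q i ≠ 0) ∧ y.q = x.q ∧
      y.p = fun i => if i ∈ L then x.p i - x.par.th i / x.q i else x.p i := by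
  induction L generalizing y with
  | nil =>
    have h' : y = x := by simpa using h
    simp [h']
  | cons a L ih =>
    simp only [List.map_cons, List.foldr_cons, mem_comp_iff] at h
    obtain ⟨z, hz, ⟨h1, rfl⟩⟩ := h
    have hn := List.nodup_cons.1 hL
    obtain ⟨i1, i2, i3⟩ := ih hn.2 hz
    have hpar := par_of_mem_foldr L hn.2 hz
    have h1' : x.q a ≠ 0 := by rw [← i2]; exact h1
    refine ⟨?_, i2, ?_⟩
    · intro i hi
      rcases List.mem_cons.1 hi with rfl | hi
      · exact h1'
      · exact i1 i hi
    · funext i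
      change Function.update z.p a (z.p a - z.par.th a / z.q a) i = _
      by_cases hi : i = a
      · subst hi
        simp [i2, i3, hpar, hn.1]
      · simp [hi, i3]

/-- The composition of all `R_{θ_j}`, in any order. -/
theorem eq_of_mem_foldr_Rth_of_forall_mem (L : List (Fin N)) (hL : L.Nodup) (hm : ∀ i, i ∈ L)
    {x y : State N} (h : y ∈ (L.map Rth).foldr PFun.comp (PFun.id _) x) :
    (∀ i, x.q i ≠ 0) ∧
      y = ⟨{ x.par with th := fun i => -x.par.th i }, x.q, fun i => x.p i - x.par.th i / x.q i⟩ := by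
  obtain ⟨h1, h2, h3⟩ := eq_of_mem_foldr_Rth L hL h
  have h4 := par_of_mem_foldr L hL h
  refine ⟨fun i => h1 i (hm i), ?_⟩
  ext i
  · simp [h4]
  · simp [h4]
  · simp [h4]
  · simp [h4, hm]
  · simp [h2]
  · simp [h3, hm]

theorem eq_of_mem_RthAll {x y : State N} (h : y ∈ RthAll N x) :
    (∀ i, x.q i ≠ 0) ∧
      y = ⟨{ x.par with th := fun i => -x.par.th i }, x.q, fun i => x.p i - x.par.th i / x.q i⟩ :=
  eq_of_mem_foldr_Rth_of_forall_mem _ (List.nodup_finRange N) List.mem_finRange h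

theorem eq_of_mem_RthAllRev {x y : State N} (h : y ∈ RthAllRev N x) :
    (∀ i, x.q i ≠ 0) ∧
      y = ⟨{ x.par with th := fun i => -x.par.th i }, x.q, fun i => x.p i - x.par.th i / x.q i⟩ :=
  eq_of_mem_foldr_Rth_of_forall_mem _ (List.nodup_reverse.2 (List.nodup_finRange N))
    (fun i => List.mem_reverse.2 (List.mem_finRange i)) h

/-! ### The total effect of l on the Hamiltonians -/

/-- The Hamiltonian at a state. -/
noncomputable def State.ham (x : State N) (i : Fin N) (s : Fin N → ℂ) : ℂ :=
  Garnier.ham x.par i x.q x.p s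

theorem ham_of_mem_Rk1 {s : Fin N → ℂ} (hs : s ∈ config N) {x y : State N} (h : y ∈ Rk1 x)
    (i : Fin N) : y.ham i s = x.ham i s - x.par.k1 * x.par.th i / (s i - 1) := by
  obtain ⟨h1, rfl⟩ := h
  exact ham_Rk1 x.par i x.q x.p hs h1

theorem ham_of_mem_Rk0 {s : Fin N → ℂ} (hs : s ∈ config N) {x y : State N} (h : y ∈ Rk0 s x)
    (i : Fin N) : y.ham i s = x.ham i s
      - x.par.k0 * x.q i / (s i ^ 2 * (∑ j, x.q j / s j - 1))
      - x.par.k0 * x.par.th i / (s i * (s i - 1)) := by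
  obtain ⟨h1, rfl⟩ := h
  exact ham_Rk0 x.par i x.q x.p hs h1.2

theorem ham_of_mem_Rtau {s : Fin N → ℂ} (hs : s ∈ config N) {x y : State N} (h : y ∈ Rtau s x)
    (i : Fin N) : y.ham i s = x.ham i s - x.q i * x.p i / s i := by
  obtain ⟨h1, rfl⟩ := h
  exact ham_Rtau x.par i x.q x.p hs h1.1 fun j => (h1.2 j).2

theorem ham_of_mem_Rkinf {s : Fin N → ℂ} {x y : State N} (h : y ∈ Rkinf x)
    (i : Fin N) : y.ham i s = x.ham i s := by
  obtain ⟨h1, rfl⟩ := h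
  exact ham_Rkinf x.par i x.q x.p s

theorem ham_of_mem_RthAll {s : Fin N → ℂ} (hs : s ∈ config N) {x y : State N}
    (h : y ∈ RthAll N x) (i : Fin N) : y.ham i s = x.ham i s
      - x.par.th i * (x.par.k1 * s i + x.par.k0 - 1) / (s i * (s i - 1)) := by
  obtain ⟨hq, rfl⟩ := eq_of_mem_RthAll h
  exact ham_RthAll x.par i x.q x.p hs hq

/-- The effect of `l` on the Hamiltonians. -/
theorem ham_of_mem_l {s : Fin N → ℂ} (hs : s ∈ config N) {x y : State N} (h : y ∈ l s x)
    (i : Fin N) : y.ham i s = x.ham i s - x.q i * x.p i / s i := by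
  have h0 := config.ne_zero hs i
  have h1 := config.sub_one_ne_zero hs i
  simp only [l, mem_comp_iff] at h
  obtain ⟨d, ⟨c, ⟨b, ⟨a, ha, hb⟩, hc⟩, hd⟩, hy⟩ := h
  -- The q_i-term of R_{κ₀} cancels against its shift of p_i inside the correction −q_i p_i / s_i of
  -- R_τ, and all terms proportional to θ_i add up to zero.
  rw [ham_of_mem_Rk1 hs hy, ham_of_mem_Rtau hs hd, ham_of_mem_RthAll hs hc, ham_of_mem_Rkinf hb,
    ham_of_mem_Rk0 hs ha]
  have ed : d.par.k1 = -c.par.k1 + 1 ∧ d.par.th i = -c.par.th i := by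
    obtain ⟨_, rfl⟩ := hd
    exact ⟨rfl, rfl⟩
  obtain ⟨hq, hc'⟩ := eq_of_mem_RthAll hc
  have ec : c.par.k1 = b.par.k1 ∧ c.par.th i = -b.par.th i
      ∧ c.q i * c.p i = b.q i * b.p i - b.par.th i := by
    rw [hc']
    refine ⟨rfl, rfl, ?_⟩
    have := hq i
    change b.q i * (b.p i - b.par.th i / b.q i) = _
    field_simp
  have eb : b.par.k1 = a.par.k1 ∧ b.par.k0 = a.par.k0 ∧ b.par.th i = a.par.th i
      ∧ b.q i = a.q i ∧ b.p i = a.p i := by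
    obtain ⟨_, rfl⟩ := hb
    exact ⟨rfl, rfl, rfl, rfl, rfl⟩
  have hg : ∑ j, x.q j / s j - 1 ≠ 0 := by
    obtain ⟨h2, _⟩ := ha
    exact h2.2
  have ea : a.par.k1 = x.par.k1 ∧ a.par.k0 = -x.par.k0 ∧ a.par.th i = x.par.th i
      ∧ a.q i = x.q i ∧ a.p i = x.p i - x.par.k0 / (s i * (∑ j, x.q j / s j - 1)) := by
    obtain ⟨_, rfl⟩ := ha
    exact ⟨rfl, rfl, rfl, rfl, rfl⟩
  rw [ed.1, ed.2, ec.1, ec.2.1, ec.2.2, eb.1, eb.2.1, eb.2.2.1, eb.2.2.2.1, eb.2.2.2.2, ea.1,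
    ea.2.1, ea.2.2.1, ea.2.2.2.1, ea.2.2.2.2]
  field_simp
  ring

/-! ### The function Z and one step of l backwards -/

/-- `(1 - ∑ q_j)(E - ∑ p_j (q_j p_j - θ_j)) - κ₁ (κ₀ - 1)`. -/
noncomputable def todaZ (k : Params N) (q p : Fin N → ℂ) : ℂ :=
  (1 - ∑ j, q j) * (quadE k q p - sumV k q p) - k.k1 * (k.k0 - 1)

/-- Let primes denote values after R_{κ₁}, the first factor of l⁻¹ to act on y. Then Z = (g − 1)(V'
− E'), whose factors are the denominator of R_{κ₁} and, up to E', the one of R_{κ₀}; hence Z ≠ 0.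
The right side of the identity is s_i ∂Z/∂s_i by `IsSolution.pd_todaZ`, so the identity says that d
log Z is the second difference of the Hamiltonians. -/
theorem todaZ_of_mem_l {s : Fin N → ℂ} {x y : State N} (h : y ∈ l s x) :
    todaZ y.par y.q y.p ≠ 0 ∧ ∀ i,
      (x.q i * x.p i - y.q i * y.p i) * todaZ y.par y.q y.p
        = -((2 * (y.q i * y.p i) - y.par.th i) * (1 - ∑ j, y.q j)
              * (quadE y.par y.q y.p - sumV y.par y.q y.p)
            + y.par.k1 * y.q i * (quadE y.par y.q y.p - sumV y.par y.q y.p)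
            + (y.par.k0 - 1) * (1 - ∑ j, y.q j) * (y.p i * (y.q i * y.p i - y.par.th i))) := by
  rw [mem_l_iff] at h
  simp only [lInv, mem_comp_iff] at h
  obtain ⟨a, ⟨b, ⟨c, ⟨d, ⟨hg, rfl⟩, hd⟩, hc⟩, ⟨_, rfl⟩⟩, ⟨hG, rfl⟩⟩ := h
  obtain ⟨hcq, rfl⟩ := eq_of_mem_RthAllRev hc
  obtain ⟨⟨hE, hi⟩, rfl⟩ := hd
  obtain ⟨e, he⟩ : ∃ e, e = y.par.k1 / (∑ j, y.q j - 1) := ⟨_, rfl⟩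
  have hk : y.par.k1 = e * (∑ j, y.q j - 1) := by
    rw [he, div_mul_cancel₀]
    exact hg
  set k' : Params N := { y.par with k1 := -y.par.k1 } with hk'
  set p' : Fin N → ℂ := fun j => y.p j - e with hp'
  have hd : (Rk1 y).get hg = ⟨k', y.q, p'⟩ := by
    ext <;> simp [Rk1, hk', hp', he]
  rw [hd] at hE hi
  change quadE k' y.q p' ≠ 0 at hE
  simp only [hd, Rtau, Rkinf, Rk0, Part.some] at hG hcq ⊢
  change _ ∧ (∑ j, s j * p' j * (y.q j * p' j - k'.th j) / quadE k' y.q p' / s j - 1) ≠ 0 at hG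
  change ∀ i, s i * p' i * (y.q i * p' i - k'.th i) / quadE k' y.q p' ≠ 0 at hcq
  simp only [show (⟨k', y.q, p'⟩ : State N).E = quadE k' y.q p' from rfl]
  -- This is ∑ Q_j / s_j − 1 after R_τ, the quantity by which R_{κ₀} divides.
  have hsum : ∑ j, s j * p' j * (y.q j * p' j - k'.th j) / quadE k' y.q p' / s j - 1
      = (sumV k' y.q p' - quadE k' y.q p') / quadE k' y.q p' := by
    rw [sub_div, div_self hE, sumV, Finset.sum_div]
    congr 1
    refine Finset.sum_congr rfl fun j _ => ?_
    have := (hi j).1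
    field_simp
  rw [hsum] at hG ⊢
  have hVE : sumV k' y.q p' - quadE k' y.q p' ≠ 0 := fun h0 => hG.2 (by rw [h0, zero_div])
  have eU : sumU y.q p' = sumU y.q y.p - e * ∑ j, y.q j := by
    simp only [sumU, hp', Finset.mul_sum, ← Finset.sum_sub_distrib]
    exact Finset.sum_congr rfl fun j _ => by ring
  have eV : sumV k' y.q p' = sumV y.par y.q y.p
      - e * (2 * sumU y.q y.p - ∑ j, y.par.th j) + e ^ 2 * ∑ j, y.q j := by
    simp only [sumV, sumU, hk', hp', Finset.mul_sum, ← Finset.sum_sub_distrib,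
      ← Finset.sum_add_distrib]
    exact Finset.sum_congr rfl fun j _ => by ring
  have hal : k'.alpha = y.par.alpha + y.par.k1 := by
    simp only [hk', Params.alpha]; ring
  have hal' : ∑ j, y.par.th j
      = -2 * y.par.alpha - y.par.k0 - y.par.k1 - y.par.kinf + 1 := by
    simp only [Params.alpha]; ring
  have hVE' : sumV k' y.q p' - quadE k' y.q p'
      = sumV y.par y.q y.p - quadE y.par y.q y.p - e * (y.par.k0 - 1) := by
    rw [eV, quadE, quadE, eU, hal, hal', show k'.kinf = y.par.kinf from rfl, hk]; ring
  have hZ : todaZ y.par y.q y.p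
      = (∑ j, y.q j - 1) * (sumV k' y.q p' - quadE k' y.q p') := by
    rw [hVE', todaZ, hk]; ring
  refine ⟨by rw [hZ]; exact mul_ne_zero hg hVE, fun i => ?_⟩
  have hsi := (hi i).1
  have hai : y.q i * p' i - k'.th i ≠ 0 := (hi i).2
  have hpi : p' i ≠ 0 := by
    intro h0
    apply hcq i
    rw [h0]; simp
  -- The left side is q_i p_i at x. R_τ gives −q_i p'_i, R_{θ_i} adds θ_i, and R_{κ₀} adds the last
  -- term.
  have hu : s i * p' i * (y.q i * p' i - k'.th i) / quadE k' y.q p'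
        * (-(y.q i * quadE k' y.q p') / (s i * (y.q i * p' i - k'.th i))
          - -k'.th i / (s i * p' i * (y.q i * p' i - k'.th i) / quadE k' y.q p')
          - (-k'.k0 + 1) / (s i * ((sumV k' y.q p' - quadE k' y.q p') / quadE k' y.q p')))
      = -(y.q i * p' i) + k'.th i
        + (k'.k0 - 1) * p' i * (y.q i * p' i - k'.th i) / (sumV k' y.q p' - quadE k' y.q p') := by
    generalize quadE k' y.q p' = E at *
    generalize sumV k' y.q p' - E = VE at *
    generalize hai' : y.q i * p' i - k'.th i = a at *
    field_simp
    ring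
  rw [hu, hZ]
  have hcancel : (k'.k0 - 1) * p' i * (y.q i * p' i - k'.th i)
      / (sumV k' y.q p' - quadE k' y.q p') * (sumV k' y.q p' - quadE k' y.q p')
      = (k'.k0 - 1) * p' i * (y.q i * p' i - k'.th i) := div_mul_cancel₀ _ hVE
  have hgen : ∀ X Y : ℂ, (X + (k'.k0 - 1) * p' i * (y.q i * p' i - k'.th i)
      / (sumV k' y.q p' - quadE k' y.q p') - Y)
        * ((∑ j, y.q j - 1) * (sumV k' y.q p' - quadE k' y.q p'))
      = (∑ j, y.q j - 1) * ((X - Y) * (sumV k' y.q p' - quadE k' y.q p')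
        + (k'.k0 - 1) * p' i * (y.q i * p' i - k'.th i)) := by
    intro X Y
    linear_combination (∑ j, y.q j - 1) * hcancel
  rw [hgen, hVE', hk]
  simp only [hk', hp']
  ring

/-! ### Directional derivatives and Hamilton's equations -/

/-- The derivative of `resid k q p i j` in the direction `(x, y)`. -/
def residD (k : Params N) (q p x y : Fin N → ℂ) (i j : Fin N) : ℂ :=
  (y i - y j) * (q i * (q j * p j - k.th j) - q j * (q i * p i - k.th i))
    + (p i - p j) * (x i * (q j * p j - k.th j) + q i * (x j * p j + q j * y j)
      - (x j * (q i * p i - k.th i) + q j * (x i * p i + q i * y i)))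

/-- The derivative of `sumU q p` in the direction `(x, y)`. -/
def sumUD (q p x y : Fin N → ℂ) : ℂ := ∑ j, (x j * p j + q j * y j)

/-- The derivative of `sumV k q p` in the direction `(x, y)`. -/
def sumVD (k : Params N) (q p x y : Fin N → ℂ) : ℂ :=
  ∑ j, (y j * (q j * p j - k.th j) + p j * (x j * p j + q j * y j))

/-- The derivative of `quadE k q p` in the direction `(x, y)`. -/
noncomputable def quadED (k : Params N) (q p x y : Fin N → ℂ) : ℂ :=
  (2 * k.alpha + k.kinf + 2 * sumU q p) * sumUD q p x y

/-- The derivative of `regPart k i q p s` in the direction `(x, y)`. -/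
noncomputable def regPartD (k : Params N) (i : Fin N) (q p s x y : Fin N → ℂ) : ℂ :=
  x i * quadE k q p + q i * quadED k q p x y
    + s i * (y i * (q i * p i - k.th i) + p i * (x i * p i + q i * y i))
    + (s i - 1) * (x i * sumV k q p + q i * sumVD k q p x y)
    - s i * ((x i * p i + q i * y i) * sumU q p + (q i * p i - k.th i) * sumUD q p x y)
    - s i * ((x i * p i + q i * y i) * (sumU q p - ∑ j, k.th j) + q i * p i * sumUD q p x y)
    + (k.k1 * s i + k.k0 - 1) * (x i * p i + q i * y i)

/-- The derivative of `H_i` with respect to `(q, p)` in the direction `(x, y)`. -/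
noncomputable def hamD (k : Params N) (i : Fin N) (q p s x y : Fin N → ℂ) : ℂ :=
  ∑ j ∈ Finset.univ.erase i, residD k q p x y i j / (s i - s j)
    + regPartD k i q p s x y / (s i * (s i - 1))

section Curves

variable {q p : ℂ → Fin N → ℂ} {x y : Fin N → ℂ} {t : ℂ}

theorem hasDerivAt_mul (hq : ∀ i, HasDerivAt (fun t => q t i) (x i) t)
    (hp : ∀ i, HasDerivAt (fun t => p t i) (y i) t) (i : Fin N) :
    HasDerivAt (fun t => q t i * p t i) (x i * p t i + q t i * y i) t :=
  (hq i).mul (hp i)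

theorem hasDerivAt_sumU (hq : ∀ i, HasDerivAt (fun t => q t i) (x i) t)
    (hp : ∀ i, HasDerivAt (fun t => p t i) (y i) t) :
    HasDerivAt (fun t => sumU (q t) (p t)) (sumUD (q t) (p t) x y) t :=
  HasDerivAt.fun_sum fun i _ => hasDerivAt_mul hq hp i

theorem hasDerivAt_sumV (k : Params N) (hq : ∀ i, HasDerivAt (fun t => q t i) (x i) t)
    (hp : ∀ i, HasDerivAt (fun t => p t i) (y i) t) :
    HasDerivAt (fun t => sumV k (q t) (p t)) (sumVD k (q t) (p t) x y) t :=
  HasDerivAt.fun_sum fun i _ => (hp i).mul ((hasDerivAt_mul hq hp i).sub_const _)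

theorem hasDerivAt_quadE (k : Params N) (hq : ∀ i, HasDerivAt (fun t => q t i) (x i) t)
    (hp : ∀ i, HasDerivAt (fun t => p t i) (y i) t) :
    HasDerivAt (fun t => quadE k (q t) (p t)) (quadED k (q t) (p t) x y) t := by
  have h := hasDerivAt_sumU hq hp
  refine ((h.const_add k.alpha).mul (h.const_add (k.alpha + k.kinf))).congr_deriv ?_
  rw [quadED]; ring

theorem hasDerivAt_ham (k : Params N) (i : Fin N) {s : Fin N → ℂ} (hs : s ∈ config N)
    (hq : ∀ i, HasDerivAt (fun t => q t i) (x i) t)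
    (hp : ∀ i, HasDerivAt (fun t => p t i) (y i) t) :
    HasDerivAt (fun t => ham k i (q t) (p t) s) (hamD k i (q t) (p t) s x y) t := by
  have hU := hasDerivAt_sumU hq hp
  have hV := hasDerivAt_sumV k hq hp
  have hE := hasDerivAt_quadE k hq hp
  have hm := hasDerivAt_mul hq hp
  simp only [ham_eq k i _ _ hs]
  refine (HasDerivAt.fun_sum fun j _ => HasDerivAt.div_const ?_ _).add
    (HasDerivAt.div_const ?_ _)
  · refine (((hp i).sub (hp j)).mul (((hq i).mul ((hm j).sub_const (k.th j))).sub
      ((hq j).mul ((hm i).sub_const (k.th i))))).congr_deriv ?_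
    simp only [residD, Pi.sub_apply, Pi.mul_apply]
  · exact ((((((hq i).mul hE).add
      (((hp i).mul ((hm i).sub_const (k.th i))).const_mul (s i))).add
      (((hq i).mul hV).const_mul (s i - 1))).sub
      ((((hm i).sub_const (k.th i)).mul hU).const_mul (s i))).sub
      (((hm i).mul (hU.sub_const (∑ j, k.th j))).const_mul (s i))).add
      ((hm i).const_mul (k.k1 * s i + k.k0 - 1))

end Curves

theorem hasDerivAt_line {f : (Fin N → ℂ) → ℂ} {s : Fin N → ℂ} (h : DifferentiableAt ℂ f s)
    (v : Fin N → ℂ) : HasDerivAt (fun t : ℂ => f (s + t • v)) (fderiv ℂ f s v) 0 :=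
  h.hasFDerivAt.hasLineDerivAt v

theorem hasDerivAt_line_apply (q x : Fin N → ℂ) (i : Fin N) (t : ℂ) :
    HasDerivAt (fun t : ℂ => (q + t • x) i) (x i) t := by
  simpa using ((hasDerivAt_id t).mul_const (x i)).const_add (q i)

theorem differentiable_ham (k : Params N) (i : Fin N) (s : Fin N → ℂ) :
    Differentiable ℂ fun z : (Fin N → ℂ) × (Fin N → ℂ) => ham k i z.1 z.2 s := by
  unfold ham
  fun_prop

theorem fderiv_ham (k : Params N) (i : Fin N) {s : Fin N → ℂ} (hs : s ∈ config N)
    (q p x y : Fin N → ℂ) :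
    fderiv ℂ (fun z : (Fin N → ℂ) × (Fin N → ℂ) => ham k i z.1 z.2 s) (q, p) (x, y)
      = hamD k i q p s x y := by
  have h1 := ((differentiable_ham k i s) (q, p)).hasFDerivAt.hasLineDerivAt (x, y)
  have h2 := hasDerivAt_ham k i hs (fun j => hasDerivAt_line_apply q x j 0)
    (fun j => hasDerivAt_line_apply p y j 0)
  simp only [zero_smul, add_zero] at h2
  exact HasDerivAt.unique h1 h2

theorem pd_ham_p (k : Params N) (i j : Fin N) {s : Fin N → ℂ} (hs : s ∈ config N)
    (q p : Fin N → ℂ) :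
    pd i (fun y => ham k j q y s) p = hamD k j q p s 0 (Pi.single i 1) := by
  have hd : DifferentiableAt ℂ (fun y => ham k j q y s) p :=
    ((differentiable_ham k j s) (q, p)).comp p
      (f := fun y : Fin N → ℂ => (q, y)) (by fun_prop)
  have h1 := hasDerivAt_line hd (Pi.single i 1)
  have h2 := hasDerivAt_ham k j hs (fun m => hasDerivAt_line_apply q 0 m 0)
    (fun m => hasDerivAt_line_apply p (Pi.single i 1) m 0)
  simp only [smul_zero, zero_smul, add_zero] at h2
  exact h1.unique h2

theorem pd_ham_q (k : Params N) (i j : Fin N) {s : Fin N → ℂ} (hs : s ∈ config N)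
    (q p : Fin N → ℂ) :
    pd i (fun x => ham k j x p s) q = hamD k j q p s (Pi.single i 1) 0 := by
  have hd : DifferentiableAt ℂ (fun x => ham k j x p s) q :=
    ((differentiable_ham k j s) (q, p)).comp q
      (f := fun x : Fin N → ℂ => (x, p)) (by fun_prop)
  have h1 := hasDerivAt_line hd (Pi.single i 1)
  have h2 := hasDerivAt_ham k j hs (fun m => hasDerivAt_line_apply q (Pi.single i 1) m 0)
    (fun m => hasDerivAt_line_apply p 0 m 0)
  simp only [smul_zero, zero_smul, add_zero] at h2
  exact h1.unique h2

/-- The explicit formula `hamD` is the value of a Fréchet derivative, hence linear in (x, y). This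
links the coordinate form of Hamilton's equations with the contracted form of `IsSolution.flow`. -/
theorem hamD_eq_sum (k : Params N) (j : Fin N) {s : Fin N → ℂ} (hs : s ∈ config N)
    (q p x y : Fin N → ℂ) :
    hamD k j q p s x y = ∑ i, (y i * hamD k j q p s 0 (Pi.single i 1)
      + x i * hamD k j q p s (Pi.single i 1) 0) := by
  simp only [← fderiv_ham k j hs]
  set L := fderiv ℂ (fun z : (Fin N → ℂ) × (Fin N → ℂ) => ham k j z.1 z.2 s) (q, p)
  have hx : x = ∑ i, x i • (Pi.single i 1 : Fin N → ℂ) := by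
    ext m; simp [Finset.sum_apply, Pi.single_apply]
  have hy : y = ∑ i, y i • (Pi.single i 1 : Fin N → ℂ) := by
    ext m; simp [Finset.sum_apply, Pi.single_apply]
  have hxy : (x, y) = ∑ i, (y i • ((0 : Fin N → ℂ), (Pi.single i 1 : Fin N → ℂ))
      + x i • ((Pi.single i 1 : Fin N → ℂ), (0 : Fin N → ℂ))) := by
    refine Prod.ext ?_ ?_
    · simp only [Prod.fst_sum, Prod.fst_add, Prod.smul_fst, smul_zero, zero_add]; exact hx
    · simp only [Prod.snd_sum, Prod.snd_add, Prod.smul_snd, smul_zero, add_zero]; exact hy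
  rw [hxy, map_sum]
  simp only [map_add, map_smul, smul_eq_mul]

/-- Hamilton's equations, contracted with an arbitrary variation `(x, y)` of `(q, p)`. -/
theorem IsSolution.flow {k : Params N} {D : Set (Fin N → ℂ)} {q p : (Fin N → ℂ) → Fin N → ℂ}
    (h : IsSolution k D q p) (hD : D ⊆ config N) {s : Fin N → ℂ} (hs : s ∈ D) (j : Fin N)
    (x y : Fin N → ℂ) :
    ∑ i, (y i * pd j (fun t => q t i) s - x i * pd j (fun t => p t i) s)
      = hamD k j (q s) (p s) s x y := by
  rw [hamD_eq_sum k j (hD hs)]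
  refine Finset.sum_congr rfl fun i _ => ?_
  rw [h.eq_q s hs, h.eq_p s hs, pd_ham_p k i j (hD hs), pd_ham_q k i j (hD hs)]
  ring

/-- Converse of `IsSolution.flow`: the coordinate variations recover both families of equations. -/
theorem isSolution_of_flow {k : Params N} {D : Set (Fin N → ℂ)}
    {q p : (Fin N → ℂ) → Fin N → ℂ} (hD : D ⊆ config N)
    (hq : DifferentiableOn ℂ q D) (hp : DifferentiableOn ℂ p D)
    (h : ∀ s ∈ D, ∀ (j : Fin N) (x y : Fin N → ℂ),
      ∑ i, (y i * pd j (fun t => q t i) s - x i * pd j (fun t => p t i) s)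
        = hamD k j (q s) (p s) s x y) : IsSolution k D q p where
  diff_q := hq
  diff_p := hp
  eq_q s hs i j := by
    rw [pd_ham_p k i j (hD hs), ← h s hs j 0 (Pi.single i 1)]
    simp [Pi.single_apply]
  eq_p s hs i j := by
    rw [pd_ham_q k i j (hD hs), ← h s hs j (Pi.single i 1) 0]
    simp [Pi.single_apply]

theorem IsSolution.mono {k : Params N} {D D' : Set (Fin N → ℂ)} {q p : (Fin N → ℂ) → Fin N → ℂ}
    (h : IsSolution k D q p) (hD : D' ⊆ D) : IsSolution k D' q p where
  diff_q := h.diff_q.mono hD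
  diff_p := h.diff_p.mono hD
  eq_q s hs := h.eq_q s (hD hs)
  eq_p s hs := h.eq_p s (hD hs)

theorem hasDerivAt_pd {D : Set (Fin N → ℂ)} (hDo : IsOpen D) {f : (Fin N → ℂ) → ℂ}
    (hf : DifferentiableOn ℂ f D) {s : Fin N → ℂ} (hs : s ∈ D) (j : Fin N) :
    HasDerivAt (fun t : ℂ => f (s + t • Pi.single j 1)) (pd j f s) 0 :=
  hasDerivAt_line (hf.differentiableAt (hDo.mem_nhds hs)) _

theorem differentiableOn_coord {D : Set (Fin N → ℂ)} {q : (Fin N → ℂ) → Fin N → ℂ}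
    (h : DifferentiableOn ℂ q D) (i : Fin N) : DifferentiableOn ℂ (fun s => q s i) D :=
  differentiableOn_pi.1 h i

theorem differentiableOn_div {D : Set (Fin N → ℂ)} {f g : (Fin N → ℂ) → ℂ}
    (hf : DifferentiableOn ℂ f D) (hg : DifferentiableOn ℂ g D) (h : ∀ s ∈ D, g s ≠ 0) :
    DifferentiableOn ℂ (fun s => f s / g s) D := by
  simp only [div_eq_mul_inv]
  exact hf.fun_mul (hg.fun_inv h)

theorem tendsto_line (q x : Fin N → ℂ) :
    Filter.Tendsto (fun t : ℂ => q + t • x) (𝓝 0) (𝓝 q) := by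
  have : Continuous fun t : ℂ => q + t • x := by fun_prop
  simpa using this.tendsto 0

/-! ### Canonical shifts of p preserve solutions -/

/-- A canonical transformation `(q, p) ↦ (q, p - φ(s, q))` maps solutions to solutions. -/
theorem IsSolution.shift {k k' : Params N} {D : Set (Fin N → ℂ)}
    {q p : (Fin N → ℂ) → Fin N → ℂ} (h : IsSolution k D q p) (hDo : IsOpen D)
    (hD : D ⊆ config N) (φ : (Fin N → ℂ) → (Fin N → ℂ) → Fin N → ℂ)
    (hφ : ∀ i, DifferentiableOn ℂ (fun s => φ s (q s) i) D)
    (G : Fin N → (Fin N → ℂ) → (Fin N → ℂ) → ℂ)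
    (hH : ∀ s ∈ D, ∀ j, ∀ᶠ x in 𝓝 (q s), ∀ y : Fin N → ℂ,
      ham k' j x (fun i => y i - φ s x i) s = ham k j x y s + G j s x)
    (hsymp : ∀ s ∈ D, ∀ (j : Fin N) (x : Fin N → ℂ), ∃ (φ' : Fin N → ℂ) (G' : ℂ),
      (∀ i, HasDerivAt (fun t : ℂ => φ s (q s + t • x) i) (φ' i) 0) ∧
      HasDerivAt (fun t : ℂ => G j s (q s + t • x)) G' 0 ∧
      ∑ i, (φ' i * pd j (fun t => q t i) s - x i * pd j (fun t => φ t (q t) i) s) = -G') :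
    IsSolution k' D q (fun s i => p s i - φ s (q s) i) := by
  refine isSolution_of_flow hD h.diff_q
    (differentiableOn_pi.2 fun i => (differentiableOn_coord h.diff_p i).sub (hφ i)) ?_
  intro s hs j x y
  -- For φ = ∂S/∂q the Hessian of S in q is symmetric, so the terms with ∂q_i/∂s_j in `hsymp`
  -- cancel. What is left says that G_j is ∂S/∂s_j up to a function of s, the usual correction of
  -- the Hamiltonian under a time-dependent change of variables.
  obtain ⟨φ', G', h1, h2, h3⟩ := hsymp s hs j x
  have d1 := hasDerivAt_ham k' j (hD hs) (fun i => hasDerivAt_line_apply (q s) x i 0)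
    (fun i => hasDerivAt_line_apply (fun i => p s i - φ s (q s) i) y i 0)
  have d2 := hasDerivAt_ham k j (hD hs) (fun i => hasDerivAt_line_apply (q s) x i 0)
    (p := fun t i => ((fun i => p s i - φ s (q s) i) + t • y) i + φ s (q s + t • x) i)
    (y := fun i => y i + φ' i)
    (fun i => (hasDerivAt_line_apply (fun i => p s i - φ s (q s) i) y i 0).add (h1 i))
  have d3 := (d2.add h2).congr_of_eventuallyEq (f₁ := fun t : ℂ =>
      ham k' j (q s + t • x) ((fun i => p s i - φ s (q s) i) + t • y) s) (by
    filter_upwards [(tendsto_line (q s) x).eventually (hH s hs j)] with t ht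
    rw [Pi.add_apply, ← ht]
    congr 1
    ext i
    simp)
  have e := d1.unique d3
  simp only [zero_smul, add_zero, sub_add_cancel] at e
  rw [e, ← h.flow hD hs, ← neg_eq_iff_eq_neg.2 h3, ← sub_eq_add_neg, ← Finset.sum_sub_distrib]
  refine Finset.sum_congr rfl fun i _ => ?_
  have hpd : pd j (fun t => p t i - φ t (q t) i) s
      = pd j (fun t => p t i) s - pd j (fun t => φ t (q t) i) s := by
    simp only [pd]
    rw [fderiv_fun_sub ((differentiableOn_coord h.diff_p i).differentiableAt (hDo.mem_nhds hs))
      ((hφ i).differentiableAt (hDo.mem_nhds hs))]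
    rfl
  rw [hpd]
  ring

theorem hasDerivAt_linear (c e x : Fin N → ℂ) (a : ℂ) :
    HasDerivAt (fun t : ℂ => ∑ m, c m * (e + t • x) m - a) (∑ m, c m * x m) 0 :=
  (HasDerivAt.fun_sum fun m _ => (hasDerivAt_line_apply e x m 0).const_mul (c m)).sub_const a

/-- The canonical transformation generated by `κ log (∑ c_m(s) q_m - 1)` maps solutions to
solutions. -/
theorem IsSolution.shift_linear {k k' : Params N} {D : Set (Fin N → ℂ)}
    {q p : (Fin N → ℂ) → Fin N → ℂ} (h : IsSolution k D q p) (hDo : IsOpen D)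
    (hD : D ⊆ config N) (κ : ℂ) (c : (Fin N → ℂ) → Fin N → ℂ) (hc : DifferentiableOn ℂ c D)
    (hf : ∀ s ∈ D, ∑ m, c s m * q s m - 1 ≠ 0) (C : Fin N → (Fin N → ℂ) → ℂ)
    (hH : ∀ s ∈ D, ∀ (j : Fin N) (x y : Fin N → ℂ), ∑ m, c s m * x m - 1 ≠ 0 →
      ham k' j x (fun i => y i - κ * c s i / (∑ m, c s m * x m - 1)) s
        = ham k j x y s
          + (κ * (∑ m, pd j (fun t => c t m) s * x m) / (∑ m, c s m * x m - 1) + C j s)) :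
    IsSolution k' D q (fun s i => p s i - κ * c s i / (∑ m, c s m * q s m - 1)) := by
  have hcq : DifferentiableOn ℂ (fun s => ∑ m, c s m * q s m - 1) D :=
    (DifferentiableOn.fun_sum fun m _ =>
      (differentiableOn_coord hc m).mul (differentiableOn_coord h.diff_q m)).sub_const 1
  have hφ : ∀ i, DifferentiableOn ℂ (fun s => κ * c s i / (∑ m, c s m * q s m - 1)) D := fun i =>
    differentiableOn_div ((differentiableOn_coord hc i).const_mul κ) hcq hf
  refine h.shift hDo hD (fun s x i => κ * c s i / (∑ m, c s m * x m - 1)) hφ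
    (fun j s x => κ * (∑ m, pd j (fun t => c t m) s * x m) / (∑ m, c s m * x m - 1) + C j s) ?_ ?_
  · intro s hs j
    have hcont : Continuous fun x : Fin N → ℂ => ∑ m, c s m * x m - 1 := by fun_prop
    filter_upwards [hcont.continuousAt.eventually_ne (hf s hs)] with x hx y
    exact hH s hs j x y hx
  · intro s hs j x
    have hfs := hf s hs
    have e0 : ∑ m, c s m * (q s + (0 : ℂ) • x) m - 1 = ∑ m, c s m * q s m - 1 := by simp
    have hf0 : ∑ m, c s m * (q s + (0 : ℂ) • x) m - 1 ≠ 0 := by rwa [e0]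
    have d1 := hasDerivAt_linear (c s) (q s) x 1
    have d2 := hasDerivAt_linear (fun m => pd j (fun t => c t m) s) (q s) x 0
    simp only [sub_zero] at d2
    refine ⟨_, _, fun i => (hasDerivAt_const 0 (κ * c s i)).fun_div d1 hf0,
      ((d2.const_mul κ).fun_div d1 hf0).add_const (C j s), ?_⟩
    have d3 : ∀ i, pd j (fun t => κ * c t i / (∑ m, c t m * q t m - 1)) s
        = (κ * pd j (fun t => c t i) s * (∑ m, c s m * q s m - 1)
          - κ * c s i * ∑ m, (pd j (fun t => c t m) s * q s m + c s m * pd j (fun t => q t m) s))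
          / (∑ m, c s m * q s m - 1) ^ 2 := by
      intro i
      have a1 := fun m => hasDerivAt_pd hDo (differentiableOn_coord hc m) hs j
      have a2 := fun m => hasDerivAt_pd hDo (differentiableOn_coord h.diff_q m) hs j
      have a3 := (HasDerivAt.fun_sum (u := Finset.univ) fun m _ => (a1 m).fun_mul (a2 m)).sub_const 1
      have a4 := ((a1 i).const_mul κ).fun_div a3 (by simpa using hfs)
      have a5 := (hasDerivAt_pd hDo (hφ i) hs j).unique a4
      simpa using a5
    simp only [d3, e0, zero_mul, zero_sub]
    simp only [zero_smul, add_zero, Finset.sum_add_distrib]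
    set f := ∑ m, c s m * q s m - 1 with hfdef
    -- The Hessian has rank one: both terms containing ∑ c_m ∂q_m/∂s_j carry the factor ∑ c_m x_m
    -- and cancel after summation.
    have s1 : ∀ i, -(κ * c s i * ∑ m, c s m * x m) / f ^ 2 * pd j (fun t => q t i) s
        - x i * ((κ * pd j (fun t => c t i) s * f
          - κ * c s i * (∑ m, pd j (fun t => c t m) s * q s m
            + ∑ m, c s m * pd j (fun t => q t m) s)) / f ^ 2)
        = -(κ * (∑ m, c s m * x m) / f ^ 2) * (c s i * pd j (fun t => q t i) s)
          - κ * f / f ^ 2 * (pd j (fun t => c t i) s * x i)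
          + κ / f ^ 2 * (∑ m, pd j (fun t => c t m) s * q s m
            + ∑ m, c s m * pd j (fun t => q t m) s) * (c s i * x i) := by
      intro i; ring
    simp only [s1]
    rw [Finset.sum_add_distrib, Finset.sum_sub_distrib, ← Finset.mul_sum, ← Finset.mul_sum,
      ← Finset.mul_sum]
    ring

/-- A family of partial transformations maps solutions of the Garnier system to solutions. -/
def PreservesSolutions (R : (Fin N → ℂ) → State N →. State N) : Prop :=
  ∀ D : Set (Fin N → ℂ), IsOpen D → D ⊆ config N →
    ∀ (k : Params N) (q p : (Fin N → ℂ) → Fin N → ℂ), IsSolution k D q p →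
      (∀ s ∈ D, (R s ⟨k, q s, p s⟩).Dom) →
      ∃ (k' : Params N) (q' p' : (Fin N → ℂ) → Fin N → ℂ), IsSolution k' D q' p' ∧
        ∀ s ∈ D, (⟨k', q' s, p' s⟩ : State N) ∈ R s ⟨k, q s, p s⟩

theorem PreservesSolutions.comp {R R' : (Fin N → ℂ) → State N →. State N}
    (h : PreservesSolutions R) (h' : PreservesSolutions R') :
    PreservesSolutions fun s => (R s).comp (R' s) := by
  intro D hDo hD k q p hqp hdom
  have hex : ∀ s ∈ D, ∃ y ∈ R' s ⟨k, q s, p s⟩, (R s y).Dom := by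
    intro s hs
    obtain ⟨y, hy, hz⟩ := (mem_comp_iff _ _ _ _).1 (Part.get_mem (hdom s hs))
    exact ⟨y, hy, Part.dom_iff_mem.2 ⟨_, hz⟩⟩
  obtain ⟨k', q', p', h1, h2⟩ := h' D hDo hD k q p hqp fun s hs => by
    obtain ⟨y, hy, _⟩ := hex s hs
    exact Part.dom_iff_mem.2 ⟨y, hy⟩
  obtain ⟨k'', q'', p'', h3, h4⟩ := h D hDo hD k' q' p' h1 fun s hs => by
    obtain ⟨y, hy, hd⟩ := hex s hs
    rwa [Part.mem_unique (h2 s hs) hy]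
  exact ⟨k'', q'', p'', h3, fun s hs => (mem_comp_iff _ _ _ _).2 ⟨_, h2 s hs, h4 s hs⟩⟩

theorem preservesSolutions_id : PreservesSolutions fun _ => PFun.id (State N) := by
  intro D _ _ k q p h _
  exact ⟨k, q, p, h, fun s _ => Part.mem_some _⟩

theorem preservesSolutions_Rkinf : PreservesSolutions fun _ => Rkinf (N := N) := by
  intro D _ _ k q p h _
  refine ⟨{ k with kinf := -k.kinf }, q, p, ⟨h.diff_q, h.diff_p, ?_, ?_⟩,
    fun s _ => Part.mem_some _⟩
  · intro s hs i j
    simp only [ham_Rkinf]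
    exact h.eq_q s hs i j
  · intro s hs i j
    simp only [ham_Rkinf]
    exact h.eq_p s hs i j

theorem preservesSolutions_Rk1 : PreservesSolutions fun _ => Rk1 (N := N) := by
  intro D hDo hD k q p h hdom
  have hg : ∀ s ∈ D, ∑ j, q s j - 1 ≠ 0 := hdom
  have := h.shift_linear (k' := { k with k1 := -k.k1 }) hDo hD k.k1 (fun _ _ => 1)
    (differentiableOn_const _) (by simpa using hg)
    (fun j s => -(k.k1 * k.th j / (s j - 1))) (by
      intro s hs j x y hx
      simp only [one_mul, mul_one] at hx ⊢
      rw [ham_Rk1 k j x y (hD hs) hx]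
      simp [pd]
      ring)
  simp only [one_mul, mul_one] at this
  exact ⟨_, _, _, this, fun s hs => ⟨hg s hs, rfl⟩⟩

theorem pd_inv_coord {s : Fin N → ℂ} (hs : ∀ i, s i ≠ 0) (j m : Fin N) :
    pd j (fun t : Fin N → ℂ => (t m)⁻¹) s = if m = j then -(1 / s j ^ 2) else 0 := by
  have hd : DifferentiableAt ℂ (fun t : Fin N → ℂ => (t m)⁻¹) s := by
    have := hs m
    fun_prop (disch := assumption)
  have h1 := hasDerivAt_line hd (Pi.single j 1)
  have h2 := (hasDerivAt_line_apply s (Pi.single j (1 : ℂ)) m 0).fun_inv (by simpa using hs m)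
  have h3 := h1.unique h2
  rw [pd, h3]
  by_cases hm : m = j
  · subst hm; simp [neg_div]
  · simp [hm]

theorem preservesSolutions_Rk0 : PreservesSolutions fun s : Fin N → ℂ => Rk0 s := by
  intro D hDo hD k q p h hdom
  have hG : ∀ s ∈ D, ∑ j, (s j)⁻¹ * q s j - 1 ≠ 0 := by
    intro s hs
    simpa only [div_eq_inv_mul] using (hdom s hs).2
  have h0 : ∀ s ∈ D, ∀ i, s i ≠ 0 := fun s hs => config.ne_zero (hD hs)
  have := h.shift_linear (k' := { k with k0 := -k.k0 }) hDo hD k.k0 (fun s i => (s i)⁻¹)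
    (differentiableOn_pi.2 fun i => by
      intro s hs
      have := h0 s hs i
      exact DifferentiableAt.differentiableWithinAt (by fun_prop (disch := assumption))) hG
    (fun j s => -(k.k0 * k.th j / (s j * (s j - 1)))) (by
      intro s hs j x y hx
      have e1 : ∑ m, (s m)⁻¹ * x m = ∑ m, x m / s m := by simp only [div_eq_inv_mul]
      have e2 : (fun i => y i - k.k0 * (s i)⁻¹ / (∑ m, x m / s m - 1))
          = fun i => y i - k.k0 / (s i * (∑ m, x m / s m - 1)) := by
        ext i; rw [← div_eq_mul_inv, div_div]
      rw [e1] at hx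
      simp only [e1]
      rw [e2, ham_Rk0 k j x y (hD hs) hx]
      simp only [pd_inv_coord (h0 s hs), ite_mul, zero_mul, Finset.sum_ite_eq', Finset.mem_univ,
        if_true]
      have := h0 s hs j
      field_simp
      ring)
  refine ⟨_, _, _, this, fun s hs => ⟨hdom s hs, ?_⟩⟩
  ext i
  · rfl
  · rfl
  · rfl
  · rfl
  · rfl
  · simp only [Rk0, div_eq_inv_mul]
    rw [mul_inv]
    ring

/-- The canonical transformation `p_i ↦ p_i - θ_i / q_i` maps solutions to solutions. -/
theorem IsSolution.flip_th {k : Params N} {D : Set (Fin N → ℂ)} {q p : (Fin N → ℂ) → Fin N → ℂ}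
    (h : IsSolution k D q p) (hDo : IsOpen D) (hD : D ⊆ config N)
    (hq : ∀ s ∈ D, ∀ i, q s i ≠ 0) :
    IsSolution { k with th := fun i => -k.th i } D q (fun s i => p s i - k.th i / q s i) := by
  have hφ : ∀ i, DifferentiableOn ℂ (fun s => k.th i / q s i) D := fun i =>
    differentiableOn_div (differentiableOn_const _) (differentiableOn_coord h.diff_q i) fun s hs => hq s hs i
  -- The generating function ∑ θ_i log q_i does not involve s, and the Hamiltonians change by
  -- functions of s alone, so G has derivative zero in q.
  refine h.shift hDo hD (fun _ x i => k.th i / x i) hφ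
    (fun j s _ => -(k.th j * (k.k1 * s j + k.k0 - 1) / (s j * (s j - 1)))) ?_ ?_
  · intro s hs j
    have : ∀ᶠ x : Fin N → ℂ in 𝓝 (q s), ∀ i, x i ≠ 0 :=
      Filter.eventually_all.2 fun i =>
        (continuous_apply i).continuousAt.eventually_ne (hq s hs i)
    filter_upwards [this] with x hx y
    rw [ham_RthAll k j x y (hD hs) hx]
    ring
  · intro s hs j x
    refine ⟨_, 0, fun i => (hasDerivAt_const 0 (k.th i)).fun_div
      (hasDerivAt_line_apply (q s) x i 0) (by simpa using hq s hs i), hasDerivAt_const _ _, ?_⟩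
    rw [neg_zero]
    refine Finset.sum_eq_zero fun i _ => ?_
    have a := (hasDerivAt_const 0 (k.th i)).fun_div
      (hasDerivAt_pd hDo (differentiableOn_coord h.diff_q i) hs j) (by simpa using hq s hs i)
    rw [(hasDerivAt_pd hDo (hφ i) hs j).unique a]
    simp
    ring

theorem preservesSolutions_RthAll : PreservesSolutions fun _ => RthAll N := by
  intro D hDo hD k q p h hdom
  have hq : ∀ s ∈ D, ∀ i, q s i ≠ 0 := fun s hs =>
    (eq_of_mem_RthAll (Part.get_mem (hdom s hs))).1
  refine ⟨_, _, _, h.flip_th hDo hD hq, fun s hs => ?_⟩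
  have e := (eq_of_mem_RthAll (Part.get_mem (hdom s hs))).2
  simpa only [e] using Part.get_mem (hdom s hs)

theorem preservesSolutions_RthAllRev : PreservesSolutions fun _ => RthAllRev N := by
  intro D hDo hD k q p h hdom
  have hq : ∀ s ∈ D, ∀ i, q s i ≠ 0 := fun s hs =>
    (eq_of_mem_RthAllRev (Part.get_mem (hdom s hs))).1
  refine ⟨_, _, _, h.flip_th hDo hD hq, fun s hs => ?_⟩
  have e := (eq_of_mem_RthAllRev (Part.get_mem (hdom s hs))).2
  simpa only [e] using Part.get_mem (hdom s hs)

/-! ### R_τ preserves solutions -/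

/-- The parameters after `R_τ`. -/
def Params.tau (k : Params N) : Params N := ⟨-k.k0 + 1, -k.k1 + 1, -k.kinf, fun i => -k.th i⟩

/-- The coordinates `q` after `R_τ`. -/
noncomputable def tauQ (k : Params N) (s q p : Fin N → ℂ) : Fin N → ℂ :=
  fun i => s i * p i * (q i * p i - k.th i) / quadE k q p

/-- The momenta `p` after `R_τ`. -/
noncomputable def tauP (k : Params N) (s q p : Fin N → ℂ) : Fin N → ℂ :=
  fun i => -(q i * quadE k q p) / (s i * (q i * p i - k.th i))

/-- The domain of `R_τ`. -/
def TauDom (k : Params N) (s q p : Fin N → ℂ) : Prop :=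
  quadE k q p ≠ 0 ∧ ∀ i, s i ≠ 0 ∧ q i * p i - k.th i ≠ 0

theorem Params.tau_tau (k : Params N) : k.tau.tau = k := by
  ext <;> simp [Params.tau]

theorem mem_Rtau {k : Params N} {s q p : Fin N → ℂ} (h : TauDom k s q p) :
    (⟨k.tau, tauQ k s q p, tauP k s q p⟩ : State N) ∈ Rtau s ⟨k, q, p⟩ := ⟨h, rfl⟩

theorem TauDom.symm {k : Params N} {s q p : Fin N → ℂ} (h : TauDom k s q p) :
    TauDom k.tau s (tauQ k s q p) (tauP k s q p) ∧
      tauQ k.tau s (tauQ k s q p) (tauP k s q p) = q ∧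
      tauP k.tau s (tauQ k s q p) (tauP k s q p) = p := by
  obtain ⟨h1, h2⟩ := Rtau_symm (mem_Rtau h)
  exact ⟨h1, congrArg State.q h2, congrArg State.p h2⟩

/-- The logarithmic derivative of `s_i (q_i p_i - θ_i) / E` in the direction `(σ, x, y)`. -/
noncomputable def tauRho (k : Params N) (s q p σ x y : Fin N → ℂ) (i : Fin N) : ℂ :=
  σ i / s i + (x i * p i + q i * y i) / (q i * p i - k.th i) - quadED k q p x y / quadE k q p

/-- The variation of `q` after `R_τ` in the direction `(σ, x, y)`. -/
noncomputable def tauQD (k : Params N) (s q p σ x y : Fin N → ℂ) (i : Fin N) : ℂ :=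
  s i * (q i * p i - k.th i) / quadE k q p * (y i + p i * tauRho k s q p σ x y i)

/-- The variation of `p` after `R_τ` in the direction `(σ, x, y)`. -/
noncomputable def tauPD (k : Params N) (s q p σ x y : Fin N → ℂ) (i : Fin N) : ℂ :=
  -(x i - q i * tauRho k s q p σ x y i) / (s i * (q i * p i - k.th i) / quadE k q p)

section Curves

variable {s q p : ℂ → Fin N → ℂ} {σ x y : Fin N → ℂ} {t : ℂ}

theorem hasDerivAt_tauQ (k : Params N) (hd : TauDom k (s t) (q t) (p t))
    (hs : ∀ i, HasDerivAt (fun t => s t i) (σ i) t)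
    (hq : ∀ i, HasDerivAt (fun t => q t i) (x i) t)
    (hp : ∀ i, HasDerivAt (fun t => p t i) (y i) t) (i : Fin N) :
    HasDerivAt (fun t => tauQ k (s t) (q t) (p t) i)
      (tauQD k (s t) (q t) (p t) σ x y i) t := by
  have hE := hasDerivAt_quadE k hq hp
  have hm := hasDerivAt_mul hq hp
  refine ((((hs i).fun_mul (hp i)).fun_mul ((hm i).sub_const (k.th i))).fun_div hE
    hd.1).congr_deriv ?_
  have h1 := hd.1
  have h2 := (hd.2 i).1
  have h3 := (hd.2 i).2
  simp only [tauQD, tauRho]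
  generalize quadE k (q t) (p t) = E at *
  generalize quadED k (q t) (p t) x y = E' at *
  generalize q t i * p t i - k.th i = a at *
  field_simp
  ring

theorem hasDerivAt_tauP (k : Params N) (hd : TauDom k (s t) (q t) (p t))
    (hs : ∀ i, HasDerivAt (fun t => s t i) (σ i) t)
    (hq : ∀ i, HasDerivAt (fun t => q t i) (x i) t)
    (hp : ∀ i, HasDerivAt (fun t => p t i) (y i) t) (i : Fin N) :
    HasDerivAt (fun t => tauP k (s t) (q t) (p t) i)
      (tauPD k (s t) (q t) (p t) σ x y i) t := by
  have hE := hasDerivAt_quadE k hq hp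
  have hm := hasDerivAt_mul hq hp
  have h1 := hd.1
  have h2 := (hd.2 i).1
  have h3 := (hd.2 i).2
  refine (((hq i).fun_mul hE).fun_neg.fun_div ((hs i).fun_mul ((hm i).sub_const (k.th i)))
    (mul_ne_zero h2 h3)).congr_deriv ?_
  simp only [tauPD, tauRho]
  generalize quadE k (q t) (p t) = E at *
  generalize quadED k (q t) (p t) x y = E' at *
  generalize q t i * p t i - k.th i = a at *
  field_simp
  ring

end Curves

/-- `R_τ` is a canonical transformation. -/
theorem tau_symplectic (k : Params N) {s q p : Fin N → ℂ} (hd : TauDom k s q p)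
    (σ x y x' y' : Fin N → ℂ) :
    ∑ i, (tauPD k s q p 0 x y i * tauQD k s q p σ x' y' i
        - tauQD k s q p 0 x y i * tauPD k s q p σ x' y' i)
      = ∑ i, (y i * x' i - x i * y' i) - ∑ i, σ i / s i * (x i * p i + q i * y i) := by
  have h1 := hd.1
  -- The last two terms cancel after summation over i, because `quadED` is a common factor times
  -- `sumUD`. The term in σ comes from the explicit factor s_i in R_τ.
  have hterm : ∀ i, tauPD k s q p 0 x y i * tauQD k s q p σ x' y' i
        - tauQD k s q p 0 x y i * tauPD k s q p σ x' y' i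
      = (y i * x' i - x i * y' i) - σ i / s i * (x i * p i + q i * y i)
        - quadED k q p x y / quadE k q p * (x' i * p i + q i * y' i)
        + quadED k q p x' y' / quadE k q p * (x i * p i + q i * y i) := by
    intro i
    have h2 := (hd.2 i).1
    have h3 := (hd.2 i).2
    simp only [tauQD, tauPD, tauRho, Pi.zero_apply]
    generalize quadE k q p = E at *
    generalize quadED k q p x y = E1 at *
    generalize quadED k q p x' y' = E2 at *
    generalize q i * p i - k.th i = a at *
    field_simp
    ring
  simp only [hterm]
  rw [Finset.sum_add_distrib, Finset.sum_sub_distrib, Finset.sum_sub_distrib, ← Finset.mul_sum,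
    ← Finset.mul_sum]
  simp only [quadED, sumUD]
  ring

/-- Linearization of `ham_Rtau`. Its correction term is the one that the explicit dependence of R_τ
on s produces in `tau_symplectic`. -/
theorem hamD_tau (k : Params N) (j : Fin N) {s q p : Fin N → ℂ} (hs : s ∈ config N)
    (hd : TauDom k s q p) (x y : Fin N → ℂ) :
    hamD k.tau j (tauQ k s q p) (tauP k s q p) s (tauQD k s q p 0 x y) (tauPD k s q p 0 x y)
      = hamD k j q p s x y - (x j * p j + q j * y j) / s j := by
  have hd0 : TauDom k s (q + (0 : ℂ) • x) (p + (0 : ℂ) • y) := by simpa using hd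
  have lx := fun i => hasDerivAt_line_apply q x i 0
  have ly := fun i => hasDerivAt_line_apply p y i 0
  have dx := hasDerivAt_tauQ k (t := 0) (s := fun _ => s) (q := fun t => q + t • x)
    (p := fun t => p + t • y) (σ := 0) hd0
    (fun i => hasDerivAt_const _ _) lx ly
  have dy := hasDerivAt_tauP k (t := 0) (s := fun _ => s) (q := fun t => q + t • x)
    (p := fun t => p + t • y) (σ := 0) hd0
    (fun i => hasDerivAt_const _ _) lx ly
  have dH := hasDerivAt_ham k.tau j hs dx dy
  have dK := (hasDerivAt_ham k j hs lx ly).fun_sub ((hasDerivAt_mul lx ly j).div_const (s j))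
  have hev : ∀ᶠ t : ℂ in 𝓝 0, TauDom k s (q + t • x) (p + t • y) := by
    have c1 := (hasDerivAt_quadE k lx ly).continuousAt.eventually_ne hd0.1
    have c2 : ∀ᶠ t : ℂ in 𝓝 0, ∀ i, (q + t • x) i * (p + t • y) i - k.th i ≠ 0 :=
      Filter.eventually_all.2 fun i =>
        ((hasDerivAt_mul lx ly i).sub_const (k.th i)).continuousAt.eventually_ne (hd0.2 i).2
    filter_upwards [c1, c2] with t h1 h2
    exact ⟨h1, fun i => ⟨(hd.2 i).1, h2 i⟩⟩
  have hee : (fun t : ℂ => ham k.tau j (tauQ k s (q + t • x) (p + t • y))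
      (tauP k s (q + t • x) (p + t • y)) s) =ᶠ[𝓝 0] fun t : ℂ => ham k j (q + t • x) (p + t • y) s
        - (q + t • x) j * (p + t • y) j / s j := by
    filter_upwards [hev] with t ht
    exact ham_Rtau k j (q + t • x) (p + t • y) hs ht.1 fun i => (ht.2 i).2
  have e := dH.unique (dK.congr_of_eventuallyEq hee)
  simp only [zero_smul, add_zero] at e
  exact e

theorem pd_of_eq_tau (k : Params N) {D : Set (Fin N → ℂ)} (hDo : IsOpen D)
    {q p Q P : (Fin N → ℂ) → Fin N → ℂ} (hq : DifferentiableOn ℂ q D)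
    (hp : DifferentiableOn ℂ p D) (hQ : DifferentiableOn ℂ Q D) (hP : DifferentiableOn ℂ P D)
    (hdom : ∀ s ∈ D, TauDom k s (Q s) (P s)) (hqe : ∀ s ∈ D, tauQ k s (Q s) (P s) = q s)
    (hpe : ∀ s ∈ D, tauP k s (Q s) (P s) = p s) {s : Fin N → ℂ} (hs : s ∈ D) (i j : Fin N) :
    pd j (fun t => q t i) s = tauQD k s (Q s) (P s) (Pi.single j 1)
        (fun i => pd j (fun t => Q t i) s) (fun i => pd j (fun t => P t i) s) i ∧
      pd j (fun t => p t i) s = tauPD k s (Q s) (P s) (Pi.single j 1)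
        (fun i => pd j (fun t => Q t i) s) (fun i => pd j (fun t => P t i) s) i := by
  obtain ⟨e, he⟩ : ∃ e : Fin N → ℂ, e = Pi.single j 1 := ⟨_, rfl⟩
  have hpd : ∀ f : (Fin N → ℂ) → ℂ, DifferentiableOn ℂ f D →
      HasDerivAt (fun t : ℂ => f (s + t • e)) (pd j f s) 0 := fun f hf => by
    rw [he]; exact hasDerivAt_pd hDo hf hs j
  rw [← he]
  have lQ : ∀ i, HasDerivAt (fun t : ℂ => Q (s + t • e) i)
      (pd j (fun t => Q t i) s) 0 := fun i => hpd _ (differentiableOn_coord hQ i)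
  have lP : ∀ i, HasDerivAt (fun t : ℂ => P (s + t • e) i)
      (pd j (fun t => P t i) s) 0 := fun i => hpd _ (differentiableOn_coord hP i)
  have ls : ∀ i, HasDerivAt (fun t : ℂ => (s + t • e) i)
      (e i) 0 := fun i => hasDerivAt_line_apply s e i 0
  have hev := (tendsto_line s e).eventually (hDo.mem_nhds hs)
  have hd0 : TauDom k (s + (0 : ℂ) • e) (Q (s + (0 : ℂ) • e))
      (P (s + (0 : ℂ) • e)) := by simpa using hdom s hs
  have aQ := hasDerivAt_tauQ k (t := (0 : ℂ)) (s := fun t : ℂ => s + t • e)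
    (q := fun t => Q (s + t • e)) (p := fun t => P (s + t • e))
    (σ := e) (x := fun i => pd j (fun t => Q t i) s)
    (y := fun i => pd j (fun t => P t i) s) hd0 ls lQ lP i
  have aP := hasDerivAt_tauP k (t := (0 : ℂ)) (s := fun t : ℂ => s + t • e)
    (q := fun t => Q (s + t • e)) (p := fun t => P (s + t • e))
    (σ := e) (x := fun i => pd j (fun t => Q t i) s)
    (y := fun i => pd j (fun t => P t i) s) hd0 ls lQ lP i
  have bQ := aQ.congr_of_eventuallyEq (f₁ := fun t : ℂ => q (s + t • e) i) (by
    filter_upwards [hev] with t ht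
    rw [hqe _ ht])
  have bP := aP.congr_of_eventuallyEq (f₁ := fun t : ℂ => p (s + t • e) i) (by
    filter_upwards [hev] with t ht
    rw [hpe _ ht])
  have cQ := (hpd _ (differentiableOn_coord hq i)).unique bQ
  have cP := (hpd _ (differentiableOn_coord hp i)).unique bP
  simp only [zero_smul, add_zero] at cQ cP
  exact ⟨cQ, cP⟩

theorem differentiableOn_tau (k : Params N) {D : Set (Fin N → ℂ)}
    {q p : (Fin N → ℂ) → Fin N → ℂ} (hq : DifferentiableOn ℂ q D) (hp : DifferentiableOn ℂ p D)
    (hdom : ∀ s ∈ D, TauDom k s (q s) (p s)) :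
    DifferentiableOn ℂ (fun s => tauQ k s (q s) (p s)) D ∧
      DifferentiableOn ℂ (fun s => tauP k s (q s) (p s)) D := by
  have hqi := differentiableOn_coord hq
  have hpi := differentiableOn_coord hp
  have hsi : ∀ i, DifferentiableOn ℂ (fun s : Fin N → ℂ => s i) D := fun i => by fun_prop
  have hui := fun i => (hqi i).fun_mul (hpi i)
  have hU : DifferentiableOn ℂ (fun s => sumU (q s) (p s)) D :=
    DifferentiableOn.fun_sum fun i _ => hui i
  have hE : DifferentiableOn ℂ (fun s => quadE k (q s) (p s)) D :=
    (hU.const_add _).fun_mul (hU.const_add _)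
  exact ⟨differentiableOn_pi.2 fun i =>
    differentiableOn_div (((hsi i).fun_mul (hpi i)).fun_mul ((hui i).sub_const _)) hE
      fun s hs => (hdom s hs).1,
    differentiableOn_pi.2 fun i =>
    differentiableOn_div ((hqi i).fun_mul hE).fun_neg ((hsi i).fun_mul ((hui i).sub_const _))
      fun s hs => mul_ne_zero ((hdom s hs).2 i).1 ((hdom s hs).2 i).2⟩

/-- The solution property is pulled back along R_τ. An arbitrary variation of (Q, P) can then be
pushed forward and tested against the flow of (q, p), so the differential of R_τ need not be
inverted. As R_τ is an involution, the forward statement follows. -/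
theorem IsSolution.of_tau {k : Params N} {D : Set (Fin N → ℂ)}
    {q p Q P : (Fin N → ℂ) → Fin N → ℂ} (hDo : IsOpen D) (hD : D ⊆ config N)
    (h : IsSolution k.tau D q p) (hQ : DifferentiableOn ℂ Q D) (hP : DifferentiableOn ℂ P D)
    (hdom : ∀ s ∈ D, TauDom k s (Q s) (P s)) (hqe : ∀ s ∈ D, tauQ k s (Q s) (P s) = q s)
    (hpe : ∀ s ∈ D, tauP k s (Q s) (P s) = p s) : IsSolution k D Q P := by
  refine isSolution_of_flow hD hQ hP ?_
  intro s hs j x y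
  have e := hamD_tau k j (hD hs) (hdom s hs) x y
  rw [hqe s hs, hpe s hs, ← h.flow hD hs] at e
  have hpd := fun i => pd_of_eq_tau k hDo h.diff_q h.diff_p hQ hP hdom hqe hpe hs i j
  have e1 : ∀ i, pd j (fun t => q t i) s = _ := fun i => (hpd i).1
  have e2 : ∀ i, pd j (fun t => p t i) s = _ := fun i => (hpd i).2
  simp only [e1, e2] at e
  have hsy := tau_symplectic k (hdom s hs) (Pi.single j 1) x y
    (fun i => pd j (fun t => Q t i) s) (fun i => pd j (fun t => P t i) s)
  have hsing : ∑ i, (Pi.single j 1 : Fin N → ℂ) i / s i * (x i * P s i + Q s i * y i)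
      = (x j * P s j + Q s j * y j) / s j := by
    rw [Finset.sum_eq_single j (fun i _ hi => by simp [hi]) (by simp)]
    simp; ring
  rw [hsing] at hsy
  exact sub_left_inj.1 (hsy.symm.trans e)

theorem preservesSolutions_Rtau : PreservesSolutions fun s : Fin N → ℂ => Rtau s := by
  intro D hDo hD k q p h hdom
  have hdom' : ∀ s ∈ D, TauDom k s (q s) (p s) := hdom
  obtain ⟨hQ, hP⟩ := differentiableOn_tau k h.diff_q h.diff_p hdom'
  rw [← k.tau_tau] at h
  exact ⟨k.tau, fun s => tauQ k s (q s) (p s), fun s => tauP k s (q s) (p s),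
    IsSolution.of_tau hDo hD h hQ hP (fun s hs => (hdom' s hs).symm.1)
      (fun s hs => (hdom' s hs).symm.2.1) (fun s hs => (hdom' s hs).symm.2.2),
    fun s hs => mem_Rtau (hdom' s hs)⟩

/-! ### Powers of l -/

theorem preservesSolutions_l : PreservesSolutions fun s : Fin N → ℂ => l s :=
  preservesSolutions_Rk1.comp (preservesSolutions_Rtau.comp (preservesSolutions_RthAll.comp
    (preservesSolutions_Rkinf.comp preservesSolutions_Rk0)))

theorem preservesSolutions_lInv : PreservesSolutions fun s : Fin N → ℂ => lInv s :=
  preservesSolutions_Rk0.comp (preservesSolutions_Rkinf.comp (preservesSolutions_RthAllRev.comp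
    (preservesSolutions_Rtau.comp preservesSolutions_Rk1)))

theorem PreservesSolutions.pIter {R : (Fin N → ℂ) → State N →. State N}
    (h : PreservesSolutions R) (n : ℕ) : PreservesSolutions fun s => pIter (R s) n := by
  induction n with
  | zero => exact preservesSolutions_id
  | succ n ih => exact h.comp ih

/-- The powers of `l` map solutions of the Garnier system to solutions. -/
theorem preservesSolutions_lPow (n : ℤ) : PreservesSolutions fun s : Fin N → ℂ => lPow s n := by
  cases n with
  | ofNat n => exact preservesSolutions_l.pIter n
  | negSucc n => exact preservesSolutions_lInv.pIter (n + 1)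

/-- For negative n the power is built from `lInv`, so its last factor is peeled off and reversed by
`mem_l_iff`. The case n = −1 is separate because n + 1 = 0 lies in the other branch of `lPow`. -/
theorem mem_l_of_mem_lPow {s : Fin N → ℂ} {n : ℤ} {x y z : State N} (hy : y ∈ lPow s n x)
    (hz : z ∈ lPow s (n + 1) x) : z ∈ l s y := by
  match n, hy, hz with
  | Int.ofNat n, hy, hz =>
    obtain ⟨w, hw, hz⟩ := (mem_comp_iff _ _ _ _).1 (show z ∈ (l s).comp (pIter (l s) n) x from hz)
    rwa [Part.mem_unique hy hw]
  | Int.negSucc 0, hy, hz =>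
    obtain ⟨w, hw, hy⟩ := (mem_comp_iff _ _ _ _).1
      (show y ∈ (lInv s).comp (pIter (lInv s) 0) x from hy)
    have hz' : z ∈ PFun.id _ x := hz
    rw [mem_l_iff, Part.mem_unique hz' hw]
    exact hy
  | Int.negSucc (n + 1), hy, hz =>
    obtain ⟨w, hw, hy⟩ := (mem_comp_iff _ _ _ _).1
      (show y ∈ (lInv s).comp (pIter (lInv s) (n + 1)) x from hy)
    have hz' : z ∈ pIter (lInv s) (n + 1) x := hz
    rw [mem_l_iff, Part.mem_unique hz' hw]
    exact hy

theorem par_of_mem_pIter_l {s : Fin N → ℂ} (n : ℕ) {x y : State N} (h : y ∈ pIter (l s) n x) :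
    y.par = { x.par with k0 := x.par.k0 + n, k1 := x.par.k1 - n } := by
  induction n generalizing y with
  | zero =>
    have h' : y = x := by simpa [pIter] using h
    simp [h']
  | succ n ih =>
    obtain ⟨w, hw, hy⟩ := (mem_comp_iff _ _ _ _).1 (show y ∈ (l s).comp (pIter (l s) n) x from h)
    rw [par_of_mem_l hy, ih hw]
    ext i
    · simp; ring
    · simp; ring
    · rfl
    · rfl

theorem par_of_mem_pIter_lInv {s : Fin N → ℂ} (n : ℕ) {x y : State N}
    (h : y ∈ pIter (lInv s) n x) :
    y.par = { x.par with k0 := x.par.k0 - n, k1 := x.par.k1 + n } := by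
  induction n generalizing y with
  | zero =>
    have h' : y = x := by simpa [pIter] using h
    simp [h']
  | succ n ih =>
    obtain ⟨w, hw, hy⟩ := (mem_comp_iff _ _ _ _).1
      (show y ∈ (lInv s).comp (pIter (lInv s) n) x from h)
    have h1 := par_of_mem_l (mem_l_iff.2 hy)
    rw [ih hw] at h1
    have h2 := congrArg Params.k0 h1
    have h3 := congrArg Params.k1 h1
    have h4 := congrArg Params.kinf h1
    have h5 := congrArg Params.th h1
    simp only at h2 h3 h4 h5
    ext i
    · simp; linear_combination -h2
    · simp; linear_combination -h3
    · simp [h4]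
    · simp [h5]

/-- `l^n` acts on the parameters as the translation by `(n, -n, 0, …, 0)`. -/
theorem par_of_mem_lPow {s : Fin N → ℂ} (n : ℤ) {x y : State N} (h : y ∈ lPow s n x) :
    y.par = { x.par with k0 := x.par.k0 + n, k1 := x.par.k1 - n } := by
  cases n with
  | ofNat n => simpa using par_of_mem_pIter_l n h
  | negSucc n =>
    rw [par_of_mem_pIter_lInv (n + 1) h]
    simp only [Int.cast_negSucc, sub_neg_eq_add]
    rfl

/-! ### The sums ∑ s_i(s_i − 1) H_i and ∑ (s_i − 1) H_i -/

theorem fderiv_eq_sum_pd (f : (Fin N → ℂ) → ℂ) (s v : Fin N → ℂ) :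
    fderiv ℂ f s v = ∑ j, v j * pd j f s := by
  have hv : v = ∑ j, v j • (Pi.single j 1 : Fin N → ℂ) := by
    ext m; simp [Finset.sum_apply, Pi.single_apply]
  conv_lhs => rw [hv, map_sum]
  simp only [map_smul, smul_eq_mul, pd]

/-- Adding the double sum to its copy with i and j exchanged replaces c_i / (s_i − s_j) by the
divided difference w_{ij}. For polynomial c this has no pole. -/
theorem sum_symmetrize {s : Fin N → ℂ} (hs : s ∈ config N) (c : Fin N → ℂ)
    (w F : Fin N → Fin N → ℂ) (hF : ∀ i j, F i j = F j i) (hF0 : ∀ i, F i i = 0)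
    (hw : ∀ i j, c i - c j = w i j * (s i - s j)) :
    2 * ∑ i, c i * ∑ j ∈ Finset.univ.erase i, F i j / (s i - s j) = ∑ i, ∑ j, w i j * F i j := by
  have h1 : ∀ i, c i * ∑ j ∈ Finset.univ.erase i, F i j / (s i - s j)
      = ∑ j, c i * (F i j / (s i - s j)) := by
    intro i
    rw [sum_univ_eq_sum_erase (by simp), Finset.mul_sum]
  simp only [h1]
  rw [two_mul]
  nth_rewrite 2 [Finset.sum_comm]
  simp only [← Finset.sum_add_distrib]
  refine Finset.sum_congr rfl fun i _ => Finset.sum_congr rfl fun j _ => ?_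
  by_cases hij : i = j
  · subst hij; simp [hF0]
  · have e1 := config.sub_ne_zero hs hij
    have e2 : s j - s i = -(s i - s j) := by ring
    rw [hF j i, e2, div_neg]
    have e3 := hw i j
    field_simp
    linear_combination F i j * e3

/-- `∑ s_i (s_i - 1) H_i`, see `sum_ham_A`. -/
noncomputable def hamA (k : Params N) (q p s : Fin N → ℂ) : ℂ :=
  (∑ j, q j) * quadE k q p + (1 - ∑ j, q j) * ∑ j, s j * (p j * (q j * p j - k.th j))
    - sumU q p * (sumU q p - ∑ j, k.th j) + k.k1 * ∑ j, s j * (q j * p j)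
    + (k.k0 - 1) * sumU q p

/-- `∑ (s_i - 1) H_i`, see `sum_ham_B`. -/
noncomputable def hamB (k : Params N) (q p s : Fin N → ℂ) : ℂ :=
  (∑ j, (s j)⁻¹ * q j) * (quadE k q p - sumV k q p) + sumV k q p
    - sumU q p * (sumU q p - ∑ j, k.th j) + k.k1 * sumU q p
    + (k.k0 - 1) * ∑ j, (s j)⁻¹ * (q j * p j)

theorem sum_sum_resid (k : Params N) (q p c : Fin N → ℂ) :
    ∑ i, ∑ j, c i * resid k q p i j
      = (∑ i, c i * (q i * p i)) * (sumU q p - ∑ j, k.th j)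
        + (∑ i, c i * (q i * p i - k.th i)) * sumU q p
        - (∑ i, c i * q i) * sumV k q p
        - (∑ i, c i * (p i * (q i * p i - k.th i))) * ∑ j, q j := by
  rw [← sum_mul_sub_th, sumU, sumV, Finset.sum_mul_sum, Finset.sum_mul_sum, Finset.sum_mul_sum,
    Finset.sum_mul_sum]
  simp only [← Finset.sum_add_distrib, ← Finset.sum_sub_distrib]
  refine Finset.sum_congr rfl fun i _ => Finset.sum_congr rfl fun j _ => ?_
  simp only [resid]
  ring

/-- By d log τ = ∑ H_i ds_i this sum is −A log τ. The divided difference of s(s − 1) is s_i + s_j −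
1. -/
theorem sum_ham_A (k : Params N) (q p : Fin N → ℂ) {s : Fin N → ℂ} (hs : s ∈ config N) :
    ∑ i, s i * (s i - 1) * ham k i q p s = hamA k q p s := by
  have h1 : ∀ i, s i * (s i - 1) * ham k i q p s
      = s i * (s i - 1) * ∑ j ∈ Finset.univ.erase i, resid k q p i j / (s i - s j)
        + regPart k i q p s := by
    intro i
    have := config.ne_zero hs i
    have := config.sub_one_ne_zero hs i
    rw [ham_eq k i q p hs]
    field_simp
  have h2 := sum_symmetrize hs (fun i => s i * (s i - 1)) (fun i j => s i + s j - 1)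
    (resid k q p) (resid_symm k q p) (resid_self k q p) (fun i j => by ring)
  have h3 : ∑ i, ∑ j, (s i + s j - 1) * resid k q p i j
      = 2 * (∑ i, ∑ j, s i * resid k q p i j) - ∑ i, ∑ j, 1 * resid k q p i j := by
    rw [two_mul]
    nth_rewrite 2 [Finset.sum_comm]
    simp only [← Finset.sum_add_distrib, ← Finset.sum_sub_distrib]
    refine Finset.sum_congr rfl fun i _ => Finset.sum_congr rfl fun j _ => ?_
    rw [resid_symm k q p j i]
    ring
  have h4 : ∑ i, regPart k i q p s = (∑ i, q i) * quadE k q p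
      + ∑ i, s i * (p i * (q i * p i - k.th i)) + (∑ i, s i * q i - ∑ i, q i) * sumV k q p
      - (∑ i, s i * (q i * p i - k.th i)) * sumU q p
      - (∑ i, s i * (q i * p i)) * (sumU q p - ∑ j, k.th j)
      + k.k1 * ∑ i, s i * (q i * p i) + (k.k0 - 1) * ∑ i, q i * p i := by
    simp only [regPart, Finset.mul_sum, Finset.sum_mul, sub_mul, ← Finset.sum_add_distrib,
      ← Finset.sum_sub_distrib]
    exact Finset.sum_congr rfl fun i _ => by ring
  have h5 := sum_sum_resid k q p s
  have h6 := sum_sum_resid k q p (fun _ => 1)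
  have hU : ∑ i, q i * p i = sumU q p := rfl
  have hV : ∑ i, p i * (q i * p i - k.th i) = sumV k q p := rfl
  simp only [one_mul, sum_mul_sub_th, hU, hV] at h3 h4 h5 h6
  simp only [h1, Finset.sum_add_distrib]
  rw [h4, hamA]
  linear_combination (1 / 2) * h2 + (1 / 2) * h3 + h5 - (1 / 2) * h6

/-- The Hamiltonian of the flow along ∑ (s_i − 1) ∂/∂s_i, which is −(A − B). The divided difference
is 1. -/
theorem sum_ham_B (k : Params N) (q p : Fin N → ℂ) {s : Fin N → ℂ} (hs : s ∈ config N) :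
    ∑ i, (s i - 1) * ham k i q p s = hamB k q p s := by
  have h1 : ∀ i, (s i - 1) * ham k i q p s
      = (s i - 1) * ∑ j ∈ Finset.univ.erase i, resid k q p i j / (s i - s j)
        + (s i)⁻¹ * regPart k i q p s := by
    intro i
    have := config.ne_zero hs i
    have := config.sub_one_ne_zero hs i
    rw [ham_eq k i q p hs]
    field_simp
  have h2 := sum_symmetrize hs (fun i => s i - 1) (fun i j => 1)
    (resid k q p) (resid_symm k q p) (resid_self k q p) (fun i j => by ring)
  have h4 : ∑ i, (s i)⁻¹ * regPart k i q p s = (∑ i, (s i)⁻¹ * q i) * quadE k q p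
      + sumV k q p + (∑ i, q i - ∑ i, (s i)⁻¹ * q i) * sumV k q p
      - (∑ i, (q i * p i - k.th i)) * sumU q p
      - (∑ i, q i * p i) * (sumU q p - ∑ j, k.th j)
      + k.k1 * ∑ i, q i * p i + (k.k0 - 1) * ∑ i, (s i)⁻¹ * (q i * p i) := by
    conv_rhs => rw [add_assoc]; enter [1, 1, 1, 1, 2]; rw [sumV]
    simp only [regPart, Finset.mul_sum, Finset.sum_mul, sub_mul, ← Finset.sum_add_distrib,
      ← Finset.sum_sub_distrib]
    refine Finset.sum_congr rfl fun i _ => ?_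
    have := config.ne_zero hs i
    field_simp
    ring
  have h6 := sum_sum_resid k q p (fun _ => 1)
  have hU : ∑ i, q i * p i = sumU q p := rfl
  have hV : ∑ i, p i * (q i * p i - k.th i) = sumV k q p := rfl
  simp only [one_mul, sum_mul_sub_th, hU, hV] at h2 h4 h6
  simp only [h1, Finset.sum_add_distrib]
  rw [h4, hamB]
  linear_combination (1 / 2) * h2 + (1 / 2) * h6

/-- The derivative of `hamB k q p s` with respect to `(q, p)` in the direction `(x, y)`. -/
noncomputable def hamBD (k : Params N) (q p s x y : Fin N → ℂ) : ℂ :=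
  (∑ j, (s j)⁻¹ * x j) * (quadE k q p - sumV k q p)
    + (∑ j, (s j)⁻¹ * q j) * (quadED k q p x y - sumVD k q p x y) + sumVD k q p x y
    - (sumUD q p x y * (sumU q p - ∑ j, k.th j) + sumU q p * sumUD q p x y)
    + k.k1 * sumUD q p x y + (k.k0 - 1) * ∑ j, (s j)⁻¹ * (x j * p j + q j * y j)

theorem sum_hamD_B (k : Params N) (q p x y : Fin N → ℂ) {s : Fin N → ℂ} (hs : s ∈ config N) :
    ∑ i, (s i - 1) * hamD k i q p s x y = hamBD k q p s x y := by
  have lx := fun i => hasDerivAt_line_apply q x i 0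
  have ly := fun i => hasDerivAt_line_apply p y i 0
  have hU := hasDerivAt_sumU lx ly
  have hV := hasDerivAt_sumV k lx ly
  have hE := hasDerivAt_quadE k lx ly
  have hm := hasDerivAt_mul lx ly
  have d1 := HasDerivAt.fun_sum (u := Finset.univ) fun i _ =>
    (hasDerivAt_ham k i hs lx ly).const_mul (s i - 1)
  simp only [sum_ham_B k _ _ hs] at d1
  have d2 := (((((HasDerivAt.fun_sum (u := Finset.univ) fun i _ =>
    (lx i).const_mul (s i)⁻¹).fun_mul (hE.fun_sub hV)).fun_add hV).fun_sub
    (hU.fun_mul (hU.sub_const (∑ j, k.th j)))).fun_add (hU.const_mul k.k1)).fun_add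
    ((HasDerivAt.fun_sum (u := Finset.univ) fun i _ =>
    (hm i).const_mul (s i)⁻¹).const_mul (k.k0 - 1))
  have e := d1.unique d2
  simp only [zero_smul, add_zero] at e
  exact e

/-! ### Poisson commutation and derivatives along solutions -/

section Brackets

variable (k : Params N) (q p s : Fin N → ℂ)

theorem th_sum_eq : ∑ j, k.th j = -2 * k.alpha - k.k0 - k.k1 - k.kinf + 1 := by
  simp only [Params.alpha]; ring

/-- `-∂/∂p_i` of `hamA`. -/
noncomputable def hamAx (i : Fin N) : ℂ :=
  (1 - ∑ j, q j) * (2 * k.alpha + k.kinf + 2 * sumU q p) * q i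
    - (1 - ∑ j, q j) * (s i * (2 * (q i * p i) - k.th i)) - k.k1 * ((s i - 1) * q i)

/-- `∂/∂q_i` of `hamA`. -/
noncomputable def hamAy (i : Fin N) : ℂ :=
  quadE k q p - ∑ j, s j * (p j * (q j * p j - k.th j))
    - (1 - ∑ j, q j) * (2 * k.alpha + k.kinf + 2 * sumU q p) * p i
    + (1 - ∑ j, q j) * (s i * p i ^ 2) + k.k1 * ((s i - 1) * p i)

/-- `hamA` and `hamB` commute with respect to the Poisson bracket. -/
theorem hamBD_hamA (hs : ∀ i, s i ≠ 0) :
    hamBD k q p s (hamAx k q p s) (hamAy k q p s) = 0 := by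
  obtain ⟨g, hg⟩ : ∃ g, g = ∑ j, q j := ⟨_, rfl⟩
  obtain ⟨e, he⟩ : ∃ e, e = 2 * k.alpha + k.kinf + 2 * sumU q p := ⟨_, rfl⟩
  obtain ⟨T, hT⟩ : ∃ T, T = ∑ j, s j * (p j * (q j * p j - k.th j)) := ⟨_, rfl⟩
  obtain ⟨E, hE⟩ : ∃ E, E = quadE k q p := ⟨_, rfl⟩
  have hx : ∀ i, hamAx k q p s i = (1 - g) * e * q i
      - (1 - g) * (s i * (2 * (q i * p i) - k.th i)) - k.k1 * ((s i - 1) * q i) := by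
    intro i; rw [hamAx, ← hg, ← he]
  have hy : ∀ i, hamAy k q p s i = E - T - (1 - g) * e * p i + (1 - g) * (s i * p i ^ 2)
      + k.k1 * ((s i - 1) * p i) := by
    intro i; rw [hamAy, ← hg, ← he, ← hE, ← hT]
  -- The derivatives of the building blocks of `hamB` along the Hamiltonian field of `hamA` are
  -- again expressed by a few such sums.
  have d1 : ∑ j, (s j)⁻¹ * hamAx k q p s j = (1 - g) * e * (∑ j, (s j)⁻¹ * q j)
      - (1 - g) * (2 * sumU q p - ∑ j, k.th j) - k.k1 * (g - ∑ j, (s j)⁻¹ * q j) := by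
    rw [hg]
    simp only [hx, sumU, Finset.mul_sum, ← Finset.sum_sub_distrib]
    rw [← hg]
    refine Finset.sum_congr rfl fun i _ => ?_
    have := hs i
    field_simp
  have d2 : sumUD q p (hamAx k q p s) (hamAy k q p s) = (E - T) * g - (1 - g) * T := by
    conv_rhs => rw [hT, hg]
    simp only [sumUD, hx, hy, Finset.mul_sum, ← Finset.sum_sub_distrib]
    rw [← hg, ← hT]
    exact Finset.sum_congr rfl fun i _ => by ring
  have d3 : sumVD k q p (hamAx k q p s) (hamAy k q p s)
      = (E - T) * (2 * sumU q p - ∑ j, k.th j) - (1 - g) * e * sumV k q p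
        + k.k1 * (T - sumV k q p) := by
    conv_rhs => enter [2]; rw [hT]
    simp only [sumVD, sumV, sumU, hx, hy, Finset.mul_sum, ← Finset.sum_sub_distrib,
      ← Finset.sum_add_distrib]
    exact Finset.sum_congr rfl fun i _ => by ring
  have d4 : ∑ j, (s j)⁻¹ * (hamAx k q p s j * p j + q j * hamAy k q p s j)
      = (E - T) * (∑ j, (s j)⁻¹ * q j) - (1 - g) * sumV k q p := by
    simp only [sumV, hx, hy, Finset.mul_sum, ← Finset.sum_sub_distrib]
    refine Finset.sum_congr rfl fun i _ => ?_
    have := hs i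
    field_simp
    ring
  rw [hamBD, quadED, d1, d2, d3, d4, ← he, ← hE, th_sum_eq]
  have he' : k.alpha = (e - k.kinf) / 2 - sumU q p := by rw [he]; ring
  rw [he']
  ring

end Brackets

/-- The derivative of `∑ s_i (s_i - 1) H_i` along `∑ (s_i - 1) ∂/∂s_i`. -/
theorem IsSolution.fderiv_hamA {k : Params N} {D : Set (Fin N → ℂ)}
    {q p : (Fin N → ℂ) → Fin N → ℂ} (h : IsSolution k D q p) (hDo : IsOpen D)
    (hD : D ⊆ config N) {s : Fin N → ℂ} (hs : s ∈ D) :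
    DifferentiableAt ℂ (fun t => hamA k (q t) (p t) t) s ∧
    fderiv ℂ (fun t => hamA k (q t) (p t) t) s (fun i => s i - 1)
      = (1 - ∑ j, q s j) * (∑ j, s j * (p s j * (q s j * p s j - k.th j)) - sumV k (q s) (p s))
        + k.k1 * ∑ j, (s j - 1) * (q s j * p s j) := by
  have hq := fun i => (differentiableOn_coord h.diff_q i).differentiableAt (hDo.mem_nhds hs)
  have hp := fun i => (differentiableOn_coord h.diff_p i).differentiableAt (hDo.mem_nhds hs)
  have hdiff : DifferentiableAt ℂ (fun t => hamA k (q t) (p t) t) s := by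
    unfold hamA quadE sumU
    fun_prop
  refine ⟨hdiff, ?_⟩
  obtain ⟨v, hv⟩ : ∃ v : Fin N → ℂ, v = fun i => s i - 1 := ⟨_, rfl⟩
  rw [← hv]
  have lq : ∀ i, HasDerivAt (fun t : ℂ => q (s + t • v) i) (fderiv ℂ (fun t => q t i) s v) 0 :=
    fun i => hasDerivAt_line (hq i) v
  have lp : ∀ i, HasDerivAt (fun t : ℂ => p (s + t • v) i) (fderiv ℂ (fun t => p t i) s v) 0 :=
    fun i => hasDerivAt_line (hp i) v
  have ls : ∀ i, HasDerivAt (fun t : ℂ => (s + t • v) i) (v i) 0 :=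
    fun i => hasDerivAt_line_apply s v i 0
  obtain ⟨x, hx⟩ : ∃ x : Fin N → ℂ, x = fun i => fderiv ℂ (fun t => q t i) s v := ⟨_, rfl⟩
  obtain ⟨y, hy⟩ : ∃ y : Fin N → ℂ, y = fun i => fderiv ℂ (fun t => p t i) s v := ⟨_, rfl⟩
  have lq' : ∀ i, HasDerivAt (fun t : ℂ => q (s + t • v) i) (x i) 0 := by rw [hx]; exact lq
  have lp' : ∀ i, HasDerivAt (fun t : ℂ => p (s + t • v) i) (y i) 0 := by rw [hy]; exact lp
  -- The contribution of the motion of (q, p) is the Poisson bracket of `hamA` with `hamB`, which is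
  -- zero.
  have hbr : ∑ i, (hamAy k (q s) (p s) s i * x i - hamAx k (q s) (p s) s i * y i) = 0 := by
    have hsum : ∀ f : (Fin N → ℂ) → ℂ, fderiv ℂ f s v = ∑ j, (s j - 1) * pd j f s := by
      intro f; rw [fderiv_eq_sum_pd, hv]
    rw [← hamBD_hamA k (q s) (p s) s (config.ne_zero (hD hs)), ← sum_hamD_B k _ _ _ _ (hD hs)]
    simp only [← h.flow hD hs, hx, hy, hsum, Finset.mul_sum]
    rw [Finset.sum_comm]
    simp only [← Finset.sum_sub_distrib]
    refine Finset.sum_congr rfl fun j _ => Finset.sum_congr rfl fun i _ => ?_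
    ring
  have hU := hasDerivAt_sumU lq' lp'
  have hE := hasDerivAt_quadE k lq' lp'
  have hm := hasDerivAt_mul lq' lp'
  have hg := HasDerivAt.fun_sum (u := Finset.univ) fun i _ => lq' i
  have hT := HasDerivAt.fun_sum (u := Finset.univ) fun i _ =>
    (ls i).fun_mul ((lp' i).fun_mul ((hm i).sub_const (k.th i)))
  have hA1 := HasDerivAt.fun_sum (u := Finset.univ) fun i _ => (ls i).fun_mul (hm i)
  have d2 := ((((hg.fun_mul hE).fun_add ((hg.const_sub 1).fun_mul hT)).fun_sub
    (hU.fun_mul (hU.sub_const (∑ j, k.th j)))).fun_add (hA1.const_mul k.k1)).fun_add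
    (hU.const_mul (k.k0 - 1))
  have e := (hasDerivAt_line hdiff v).unique d2
  simp only [zero_smul, add_zero] at e
  rw [e, ← sub_eq_zero, ← hbr]
  obtain ⟨U, hUd⟩ : ∃ U, U = sumU (q s) (p s) := ⟨_, rfl⟩
  obtain ⟨ε, he⟩ : ∃ e, e = 2 * k.alpha + k.kinf + 2 * U := ⟨_, rfl⟩
  obtain ⟨g, hgd⟩ : ∃ g, g = ∑ j, q s j := ⟨_, rfl⟩
  obtain ⟨E, hEd⟩ : ∃ E, E = quadE k (q s) (p s) := ⟨_, rfl⟩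
  obtain ⟨T, hTd⟩ : ∃ T, T = ∑ j, s j * (p s j * (q s j * p s j - k.th j)) := ⟨_, rfl⟩
  have hth : ∑ j, k.th j = 2 * U - ε - k.k0 - k.k1 + 1 := by
    rw [th_sum_eq, he]; ring
  simp only [hamAx, hamAy, quadED, ← hUd, ← he, ← hgd, ← hEd, ← hTd, hth]
  have e1 : (∑ i, (v i * (p s i * (q s i * p s i - k.th i)) + s i * (y i * (q s i * p s i - k.th i)
      + p s i * (x i * p s i + q s i * y i)))) = T - sumV k (q s) (p s)
        + ∑ i, (s i * (y i * (2 * (q s i * p s i) - k.th i) + x i * p s i ^ 2)) := by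
    rw [hTd, sumV, ← Finset.sum_sub_distrib, ← Finset.sum_add_distrib]
    refine Finset.sum_congr rfl fun i _ => ?_
    simp only [hv]; ring
  have e2 : (∑ i, (v i * (q s i * p s i) + s i * (x i * p s i + q s i * y i)))
      = ∑ j, (s j - 1) * (q s j * p s j) + ∑ i, s i * (x i * p s i + q s i * y i) := by
    rw [← Finset.sum_add_distrib]
    refine Finset.sum_congr rfl fun i _ => ?_
    simp only [hv]
  rw [e1, e2]
  have e3 : ∑ i, ((E - T - (1 - g) * ε * p s i + (1 - g) * (s i * p s i ^ 2)
        + k.k1 * ((s i - 1) * p s i)) * x i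
      - ((1 - g) * ε * q s i - (1 - g) * (s i * (2 * (q s i * p s i) - k.th i))
        - k.k1 * ((s i - 1) * q s i)) * y i)
      = (E - T) * (∑ i, x i) - (1 - g) * ε * sumUD (q s) (p s) x y
        + (1 - g) * ∑ i, (s i * (y i * (2 * (q s i * p s i) - k.th i) + x i * p s i ^ 2))
        + k.k1 * (∑ i, s i * (x i * p s i + q s i * y i) - sumUD (q s) (p s) x y) := by
    simp only [sumUD, Finset.mul_sum, ← Finset.sum_sub_distrib, ← Finset.sum_add_distrib]
    exact Finset.sum_congr rfl fun i _ => by ring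
  rw [e3]
  ring

/-- The logarithmic derivative of `Z` along the flows. -/
theorem IsSolution.pd_todaZ {k : Params N} {D : Set (Fin N → ℂ)}
    {q p : (Fin N → ℂ) → Fin N → ℂ} (h : IsSolution k D q p) (hDo : IsOpen D)
    (hD : D ⊆ config N) {s : Fin N → ℂ} (hs : s ∈ D) (j : Fin N) :
    DifferentiableAt ℂ (fun t => todaZ k (q t) (p t)) s ∧
    s j * pd j (fun t => todaZ k (q t) (p t)) s
      = -((2 * (q s j * p s j) - k.th j) * (1 - ∑ i, q s i)
              * (quadE k (q s) (p s) - sumV k (q s) (p s))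
            + k.k1 * q s j * (quadE k (q s) (p s) - sumV k (q s) (p s))
            + (k.k0 - 1) * (1 - ∑ i, q s i) * (p s j * (q s j * p s j - k.th j))) := by
  have hq := fun i => (differentiableOn_coord h.diff_q i).differentiableAt (hDo.mem_nhds hs)
  have hp := fun i => (differentiableOn_coord h.diff_p i).differentiableAt (hDo.mem_nhds hs)
  have hdiff : DifferentiableAt ℂ (fun t => todaZ k (q t) (p t)) s := by
    unfold todaZ quadE sumV sumU
    fun_prop
  refine ⟨hdiff, ?_⟩
  have h0 := config.ne_zero (hD hs) j
  have h1 := config.sub_one_ne_zero (hD hs) j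
  obtain ⟨v, hv⟩ : ∃ v : Fin N → ℂ, v = Pi.single j 1 := ⟨_, rfl⟩
  obtain ⟨x, hx⟩ : ∃ x : Fin N → ℂ, x = fun i => pd j (fun t => q t i) s := ⟨_, rfl⟩
  obtain ⟨y, hy⟩ : ∃ y : Fin N → ℂ, y = fun i => pd j (fun t => p t i) s := ⟨_, rfl⟩
  have lq : ∀ i, HasDerivAt (fun t : ℂ => q (s + t • v) i) (x i) 0 := by
    rw [hx, hv]; exact fun i => hasDerivAt_line (hq i) _
  have lp : ∀ i, HasDerivAt (fun t : ℂ => p (s + t • v) i) (y i) 0 := by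
    rw [hy, hv]; exact fun i => hasDerivAt_line (hp i) _
  have hE := hasDerivAt_quadE k lq lp
  have hV := hasDerivAt_sumV k lq lp
  have hg := HasDerivAt.fun_sum (u := Finset.univ) fun i _ => lq i
  have d2 := ((hg.const_sub 1).fun_mul (hE.fun_sub hV)).sub_const (k.k1 * (k.k0 - 1))
  have e := (hasDerivAt_line hdiff v).unique d2
  simp only [zero_smul, add_zero] at e
  rw [hv] at e
  change pd j _ s = _ at e
  obtain ⟨ε, he⟩ : ∃ e, e = 2 * k.alpha + k.kinf + 2 * sumU (q s) (p s) := ⟨_, rfl⟩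
  obtain ⟨g, hgd⟩ : ∃ g, g = ∑ j, q s j := ⟨_, rfl⟩
  obtain ⟨W, hW⟩ : ∃ W, W = quadE k (q s) (p s) - sumV k (q s) (p s) := ⟨_, rfl⟩
  -- The pair (x', y') = (−∂Z/∂p, ∂Z/∂q). Testing the flow with it gives the derivative of Z, which
  -- has no explicit dependence on s.
  obtain ⟨x', hx'⟩ : ∃ x' : Fin N → ℂ, x' = fun i =>
    -((1 - g) * (ε * q s i - (2 * (q s i * p s i) - k.th i))) := ⟨_, rfl⟩
  obtain ⟨y', hy'⟩ : ∃ y' : Fin N → ℂ, y' = fun i =>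
    -W + (1 - g) * (ε * p s i - p s i ^ 2) := ⟨_, rfl⟩
  have hflow := h.flow hD hs j x' y'
  have e1 : pd j (fun t => todaZ k (q t) (p t)) s = hamD k j (q s) (p s) s x' y' := by
    rw [e, ← hflow, ← hgd, ← hW, quadED, ← he]
    have : ∑ i, (y' i * pd j (fun t => q t i) s - x' i * pd j (fun t => p t i) s)
        = -(W * ∑ i, x i) + (1 - g) * (ε * sumUD (q s) (p s) x y - sumVD k (q s) (p s) x y) := by
      simp only [sumUD, sumVD, hx', hy', hx, hy, Finset.mul_sum, ← Finset.sum_sub_distrib,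
        ← Finset.sum_add_distrib, ← Finset.sum_neg_distrib]
      exact Finset.sum_congr rfl fun i _ => by ring
    rw [this]
    ring
  -- Z depends on (q, p) only through ∑ q_j, U and V, the total sl₂ generators up to constants, and
  -- these Poisson commute with every residue.
  have e2 : ∀ i m, residD k (q s) (p s) x' y' i m = 0 := by
    intro i m
    simp only [residD, hx', hy']
    ring
  have e3 : sumUD (q s) (p s) x' y' = -(W * g) + (1 - g) * sumV k (q s) (p s) := by
    conv_rhs => rw [hgd]
    simp only [sumUD, sumV, hx', hy', Finset.mul_sum, ← Finset.sum_neg_distrib,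
      ← Finset.sum_add_distrib]
    rw [← hgd]
    exact Finset.sum_congr rfl fun i _ => by ring
  have e4 : sumVD k (q s) (p s) x' y' = -(W * (2 * sumU (q s) (p s) - ∑ i, k.th i))
      + (1 - g) * ε * sumV k (q s) (p s) := by
    simp only [sumVD, sumU, sumV, hx', hy', Finset.mul_sum, ← Finset.sum_neg_distrib,
      ← Finset.sum_add_distrib, ← Finset.sum_sub_distrib]
    exact Finset.sum_congr rfl fun i _ => by ring
  have hth : ∑ j, k.th j = 2 * sumU (q s) (p s) - ε - k.k0 - k.k1 + 1 := by
    rw [th_sum_eq, he]; ring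
  have hEW : quadE k (q s) (p s) = W + sumV k (q s) (p s) := by rw [hW]; ring
  rw [e1, hamD, Finset.sum_eq_zero (fun m _ => by rw [e2, zero_div]), zero_add, regPartD, quadED,
    e3, e4, ← he, hth, ← hgd, hEW]
  simp only [hx', hy']
  field_simp
  ring

/-! ### The coordinates ξ, the function ψ and the fields X, Y -/

theorem ne_one_of_sOf_mem {xi : Fin N → ℂ} (h : sOf xi ∈ config N) (i : Fin N) :
    xi i - 1 ≠ 0 := by
  intro h0
  -- At ξ_i = 1 division by zero yields s_i = 0, which is excluded.
  exact config.ne_zero h i (by simp [sOf, h0])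

theorem hasFDerivAt_sOf {xi : Fin N → ℂ} (h : ∀ i, xi i - 1 ≠ 0) :
    HasFDerivAt sOf (ContinuousLinearMap.pi fun i =>
      (-(1 / (xi i - 1) ^ 2)) • (ContinuousLinearMap.proj i : (Fin N → ℂ) →L[ℂ] ℂ)) xi := by
  refine hasFDerivAt_pi.2 fun i => ?_
  have h1 : HasDerivAt (fun z : ℂ => z / (z - 1)) (-(1 / (xi i - 1) ^ 2)) (xi i) :=
    ((hasDerivAt_id (xi i)).fun_div ((hasDerivAt_id (xi i)).sub_const 1) (h i)).congr_deriv
      (by simp only [id]; ring)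
  have h2 : HasFDerivAt (fun f : Fin N → ℂ => f i)
      (ContinuousLinearMap.proj i : (Fin N → ℂ) →L[ℂ] ℂ) xi := hasFDerivAt_apply i xi
  exact HasDerivAt.comp_hasFDerivAt (h₂ := fun z : ℂ => z / (z - 1))
    (f := fun f : Fin N → ℂ => f i) xi h1 h2

theorem preimage_sOf_mem_nhds {W : Set (Fin N → ℂ)} (hWo : IsOpen W) (hW : W ⊆ config N)
    {xi : Fin N → ℂ} (h : sOf xi ∈ W) : sOf ⁻¹' W ∈ 𝓝 xi :=
  (hasFDerivAt_sOf (ne_one_of_sOf_mem (hW h))).continuousAt.preimage_mem_nhds (hWo.mem_nhds h)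

/-- `A` acts as `-∑ s_i (s_i - 1) ∂/∂s_i`. -/
theorem fderiv_comp_sOf_A {f : (Fin N → ℂ) → ℂ} {xi : Fin N → ℂ} (h : ∀ i, xi i - 1 ≠ 0)
    (hf : DifferentiableAt ℂ f (sOf xi)) :
    fderiv ℂ (fun x => f (sOf x)) xi xi
      = fderiv ℂ f (sOf xi) fun i => -(sOf xi i * (sOf xi i - 1)) := by
  have h1 : HasFDerivAt (fun x => f (sOf x)) _ xi := hf.hasFDerivAt.comp xi (hasFDerivAt_sOf h)
  rw [h1.fderiv, ContinuousLinearMap.comp_apply]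
  congr 1
  ext i
  have := h i
  simp only [ContinuousLinearMap.coe_pi', smul_apply,
    ContinuousLinearMap.proj_apply, smul_eq_mul, sOf]
  field_simp
  ring

/-- `A - B` acts as `-∑ (s_i - 1) ∂/∂s_i`. -/
theorem fderiv_comp_sOf_AB {f : (Fin N → ℂ) → ℂ} {xi : Fin N → ℂ} (h : ∀ i, xi i - 1 ≠ 0)
    (hf : DifferentiableAt ℂ f (sOf xi)) :
    fderiv ℂ (fun x => f (sOf x)) xi (vecA xi - vecB xi)
      = -fderiv ℂ f (sOf xi) fun i => sOf xi i - 1 := by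
  have h1 : HasFDerivAt (fun x => f (sOf x)) _ xi := hf.hasFDerivAt.comp xi (hasFDerivAt_sOf h)
  rw [h1.fderiv, ContinuousLinearMap.comp_apply, ← map_neg]
  congr 1
  ext i
  have := h i
  simp only [ContinuousLinearMap.coe_pi', smul_apply,
    ContinuousLinearMap.proj_apply, smul_eq_mul, sOf, vecA, vecB, Pi.sub_apply, Pi.neg_apply]
  field_simp
  ring

theorem sum_card_Iio (N : ℕ) : ((∑ i : Fin N, (Finset.Iio i).card : ℕ) : ℂ) * 2
    = (N : ℂ) * ((N : ℂ) - 1) := by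
  have h : (∑ i : Fin N, (Finset.Iio i).card) * 2 = N * (N - 1) := by
    simp only [Fin.card_Iio]
    rw [Fin.sum_univ_eq_sum_range (fun i => i), Finset.sum_range_id_mul_two]
  rcases Nat.eq_zero_or_pos N with rfl | hN
  · simp
  · have h' := congrArg (fun n : ℕ => (n : ℂ)) h
    simp only [Nat.cast_mul, Nat.cast_sub hN, Nat.cast_one, Nat.cast_ofNat] at h'
    exact h'

section LogDelta

variable {O : Set (Fin N → ℂ)} {L : (Fin N → ℂ) → ℂ} {xi : Fin N → ℂ}

/-- Obtained by differentiating exp L = Δ along a line, so only the logarithmic derivative of the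
polynomial Δ is needed. -/
theorem IsLogDelta.fderiv_eq (h : IsLogDelta O L) (hO : O ∈ 𝓝 xi) {v : Fin N → ℂ} {m : ℂ}
    (hm : HasDerivAt (fun t : ℂ => Delta (xi + t • v)) (m * Delta xi) 0) :
    fderiv ℂ L xi v = m := by
  have hd : DifferentiableAt ℂ L xi := h.diff.differentiableAt hO
  have h1 := (hasDerivAt_line hd v).cexp
  have h2 := h1.congr_of_eventuallyEq (f₁ := fun t : ℂ => Delta (xi + t • v)) (by
    filter_upwards [(tendsto_line xi v).eventually hO] with t ht
    exact (h.exp_eq _ ht).symm)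
  have h3 := hm.unique h2
  simp only [zero_smul, add_zero] at h3
  rw [h.exp_eq _ (mem_of_mem_nhds hO), mul_comm] at h3
  have hne : Delta xi ≠ 0 := by
    rw [← h.exp_eq _ (mem_of_mem_nhds hO)]
    exact Complex.exp_ne_zero _
  exact (mul_left_cancel₀ hne h3).symm

/-- Euler's relation: Δ is homogeneous of degree N(N − 1)/2. The exponent in ψ normalizes this to Aψ
= ψ. -/
theorem IsLogDelta.fderiv_A (h : IsLogDelta O L) (hO : O ∈ 𝓝 xi) :
    fderiv ℂ L xi xi = (N : ℂ) * ((N : ℂ) - 1) / 2 := by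
  refine h.fderiv_eq hO ?_
  have e : ∀ t : ℂ, Delta (xi + t • xi)
      = (1 + t) ^ (∑ i : Fin N, (Finset.Iio i).card) * Delta xi := by
    intro t
    simp only [Delta]
    rw [← Finset.prod_pow_eq_pow_sum, ← Finset.prod_mul_distrib]
    refine Finset.prod_congr rfl fun i _ => ?_
    rw [← Finset.prod_const, ← Finset.prod_mul_distrib]
    refine Finset.prod_congr rfl fun j _ => ?_
    simp only [Pi.add_apply, Pi.smul_apply, smul_eq_mul]
    ring
  simp only [e]
  refine ((((hasDerivAt_id (0 : ℂ)).const_add 1).fun_pow _).mul_const _).congr_deriv ?_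
  rw [← sum_card_Iio N]
  simp

/-- Δ is invariant under simultaneous translation of all ξ_i. -/
theorem IsLogDelta.fderiv_B (h : IsLogDelta O L) (hO : O ∈ 𝓝 xi) :
    fderiv ℂ L xi (vecB xi) = 0 := by
  refine h.fderiv_eq hO ?_
  have e : ∀ t : ℂ, Delta (xi + t • vecB xi) = Delta xi := by
    intro t
    simp only [Delta, vecB, Pi.add_apply, Pi.smul_apply]
    refine Finset.prod_congr rfl fun i _ => Finset.prod_congr rfl fun j _ => ?_
    ring
  simp only [e, zero_mul]
  exact hasDerivAt_const _ _

theorem hasFDerivAt_psiPow (hd : DifferentiableAt ℂ L xi) (a : ℂ) :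
    HasFDerivAt (psiPow L a)
      (psiPow L a xi • (a • ((2 / ((N : ℂ) * ((N : ℂ) - 1))) • fderiv ℂ L xi))) xi :=
  ((hd.hasFDerivAt.const_mul (2 / ((N : ℂ) * ((N : ℂ) - 1)))).const_mul a).cexp

theorem fderiv_psiPow_A (hN : 2 ≤ N) (h : IsLogDelta O L) (hO : O ∈ 𝓝 xi) (a : ℂ) :
    fderiv ℂ (psiPow L a) xi xi = a * psiPow L a xi := by
  have h0 : (N : ℂ) ≠ 0 := by
    have : N ≠ 0 := by omega
    exact_mod_cast this
  have h1 : (N : ℂ) - 1 ≠ 0 := by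
    rw [sub_ne_zero]
    have : N ≠ 1 := by omega
    exact_mod_cast this
  rw [(hasFDerivAt_psiPow (h.diff.differentiableAt hO) a).fderiv]
  simp only [smul_apply, smul_eq_mul, h.fderiv_A hO]
  field_simp

theorem fderiv_psiPow_B (h : IsLogDelta O L) (hO : O ∈ 𝓝 xi) (a : ℂ) :
    fderiv ℂ (psiPow L a) xi (vecB xi) = 0 := by
  rw [(hasFDerivAt_psiPow (h.diff.differentiableAt hO) a).fderiv]
  simp only [smul_apply, h.fderiv_B hO, smul_zero]

theorem psiPow_add (L : (Fin N → ℂ) → ℂ) (a b : ℂ) (xi : Fin N → ℂ) :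
    psiPow L (a + b) xi = psiPow L a xi * psiPow L b xi := by
  rw [psiPow, psiPow, psiPow, ← Complex.exp_add]
  congr 1
  ring

theorem psiPow_ne_zero (L : (Fin N → ℂ) → ℂ) (a : ℂ) (xi : Fin N → ℂ) : psiPow L a xi ≠ 0 :=
  Complex.exp_ne_zero _

/-- The vector fields `X` and `Y` commute. -/
theorem lieBracket_vecX_vecY (hN : 2 ≤ N) (h : IsLogDelta O L) (hO : O ∈ 𝓝 xi) :
    VectorField.lieBracket ℂ (vecX L) (vecY L) xi = 0 := by
  have hψ : HasFDerivAt (psi L) (fderiv ℂ (psi L) xi) xi :=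
    (hasFDerivAt_psiPow (h.diff.differentiableAt hO) 1).differentiableAt.hasFDerivAt
  have hA : HasFDerivAt (vecA (N := N)) (ContinuousLinearMap.id ℂ (Fin N → ℂ)) xi :=
    hasFDerivAt_id xi
  have hB : HasFDerivAt (fun x => vecA (N := N) x - vecB x)
      (ContinuousLinearMap.id ℂ (Fin N → ℂ)) xi :=
    (hasFDerivAt_id xi).sub_const (fun _ => (1 : ℂ))
  have hX : HasFDerivAt (vecX L) _ xi := hψ.smul hB
  have hY : HasFDerivAt (vecY L) _ xi := hψ.smul hA
  -- With Aψ = ψ, Bψ = 0 and [A − B, A] = −B, the bracket is ψ²(−B + A − (A − B)) = 0.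
  have pA : fderiv ℂ (psi L) xi (vecA xi) = psi L xi := by
    have := fderiv_psiPow_A hN h hO 1
    rwa [one_mul] at this
  have pB : fderiv ℂ (psi L) xi (vecB xi) = 0 := fderiv_psiPow_B h hO 1
  rw [VectorField.lieBracket, hX.fderiv, hY.fderiv]
  simp only [vecX, vecY, add_apply, smul_apply,
    ContinuousLinearMap.smulRight_apply, ContinuousLinearMap.id_apply, map_smul, map_sub, pA, pB]
  module

/-- `XY log (ψ^a τ) = ψ² Z` for a `τ`-function of a solution. -/
theorem along_alongLog (hN : 2 ≤ N) {D W : Set (Fin N → ℂ)} (hWo : IsOpen W)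
    (hWD : W ⊆ D) (hWc : W ⊆ config N) (h : IsLogDelta (sOf ⁻¹' D) L) {k : Params N}
    {q p : (Fin N → ℂ) → Fin N → ℂ} (hsol : IsSolution k W q p) {tau : (Fin N → ℂ) → ℂ}
    (htd : DifferentiableOn ℂ tau W) (ht0 : ∀ s ∈ W, tau s ≠ 0)
    (htl : ∀ s ∈ W, ∀ i, pd i tau s / tau s = ham k i (q s) (p s) s) {a : ℂ}
    (ha : a = -k.k1 * (k.k0 - 1) + k.alpha * (k.alpha + k.kinf)) (hxi : sOf xi ∈ W) :
    along (vecX L) (alongLog (vecY L) fun x => psiPow L a x * tau (sOf x)) xi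
      = psi L xi ^ 2 * todaZ k (q (sOf xi)) (p (sOf xi)) := by
  have hWn : ∀ {x}, sOf x ∈ W → sOf ⁻¹' D ∈ 𝓝 x := fun hx =>
    Filter.mem_of_superset (preimage_sOf_mem_nhds hWo hWc hx) (Set.preimage_mono hWD)
  have hlog : ∀ x, sOf x ∈ W → alongLog (vecY L) (fun x => psiPow L a x * tau (sOf x)) x
      = psi L x * (a - hamA k (q (sOf x)) (p (sOf x)) (sOf x)) := by
    intro x hx
    have hO := hWn hx
    have h1 := ne_one_of_sOf_mem (hWc hx)
    have htx := htd.differentiableAt (hWo.mem_nhds hx)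
    have hcomp : DifferentiableAt ℂ (fun x => tau (sOf x)) x :=
      htx.comp x (hasFDerivAt_sOf h1).differentiableAt
    have hψ := (hasFDerivAt_psiPow (h.diff.differentiableAt hO) a).differentiableAt
    have hA : fderiv ℂ (fun x => tau (sOf x)) x x
        = -(hamA k (q (sOf x)) (p (sOf x)) (sOf x) * tau (sOf x)) := by
      rw [fderiv_comp_sOf_A h1 htx, fderiv_eq_sum_pd, ← sum_ham_A k _ _ (hWc hx), Finset.sum_mul,
        ← Finset.sum_neg_distrib]
      refine Finset.sum_congr rfl fun i _ => ?_
      rw [← htl _ hx i]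
      have := ht0 _ hx
      field_simp
    rw [alongLog, along, vecY, map_smul, vecA, fderiv_fun_mul hψ hcomp]
    simp only [add_apply, smul_apply, smul_eq_mul, hA,
      fderiv_psiPow_A hN h hO a]
    have h2 := ht0 _ hx
    have h3 := psiPow_ne_zero L a x
    field_simp
    ring
  have hO := hWn hxi
  have h1 := ne_one_of_sOf_mem (hWc hxi)
  obtain ⟨hAd, hAe⟩ := hsol.fderiv_hamA hWo hWc hxi
  have hcomp : DifferentiableAt ℂ (fun x => hamA k (q (sOf x)) (p (sOf x)) (sOf x)) xi :=
    hAd.comp xi (hasFDerivAt_sOf h1).differentiableAt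
  have hψ : DifferentiableAt ℂ (psi L) xi :=
    (hasFDerivAt_psiPow (h.diff.differentiableAt hO) 1).differentiableAt
  have hev : (alongLog (vecY L) fun x => psiPow L a x * tau (sOf x)) =ᶠ[𝓝 xi]
      fun x => psi L x * (a - hamA k (q (sOf x)) (p (sOf x)) (sOf x)) := by
    filter_upwards [preimage_sOf_mem_nhds hWo hWc hxi] with x hx
    exact hlog x hx
  have hAB := fderiv_comp_sOf_AB h1 hAd
  rw [hAe] at hAB
  have pAB : fderiv ℂ (psi L) xi (vecA xi - vecB xi) = psi L xi := by
    have e1 := fderiv_psiPow_A hN h hO 1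
    have e2 : fderiv ℂ (psi L) xi (vecB xi) = 0 := fderiv_psiPow_B h hO 1
    rw [one_mul] at e1
    rw [map_sub, e2, sub_zero]
    exact e1
  rw [along, hev.fderiv_eq, vecX, map_smul, fderiv_fun_mul hψ (hcomp.const_sub a),
    fderiv_const_sub]
  simp only [add_apply, smul_apply, smul_eq_mul,
    neg_apply, pAB, hAB]
  -- What remains is a − `hamA` plus its explicit derivative. The terms weighted by s_j cancel, and
  -- expressing ∑ θ_j through α turns the rest into a − α(α + κ_∞) + (1 − g)(E − V), which is Z for
  -- the given a.
  rw [todaZ, hamA, quadE, ha, th_sum_eq]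
  simp only [sub_mul, one_mul, Finset.sum_sub_distrib]
  simp only [← sumU.eq_1 (q (sOf xi)) (p (sOf xi))]
  ring

end LogDelta

/-! ### The Toda equation -/

/-- `Z τ_n² / (τ_{n-1} τ_{n+1})` is locally constant. -/
theorem fderiv_toda_quotient {k : Params N} {W : Set (Fin N → ℂ)} (hWo : IsOpen W)
    (hWc : W ⊆ config N) {q p : (Fin N → ℂ) → Fin N → ℂ} (hsol : IsSolution k W q p)
    {t0 t1 t2 : (Fin N → ℂ) → ℂ} (hd0 : DifferentiableOn ℂ t0 W) (hd1 : DifferentiableOn ℂ t1 W)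
    (hd2 : DifferentiableOn ℂ t2 W) {s : Fin N → ℂ} (hs : s ∈ W) {x z : State N}
    (hx : (⟨k, q s, p s⟩ : State N) ∈ l s x) (hz : z ∈ l s ⟨k, q s, p s⟩)
    (hn0 : t0 s ≠ 0) (hn1 : t1 s ≠ 0) (hn2 : t2 s ≠ 0)
    (h0 : ∀ i, pd i t0 s / t0 s = x.ham i s)
    (h1 : ∀ i, pd i t1 s / t1 s = ham k i (q s) (p s) s)
    (h2 : ∀ i, pd i t2 s / t2 s = z.ham i s) :
    fderiv ℂ (fun t => todaZ k (q t) (p t) * t1 t ^ 2 * (t0 t * t2 t)⁻¹) s = 0 := by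
  have hs' := hWc hs
  have a0 := hd0.differentiableAt (hWo.mem_nhds hs)
  have a1 := hd1.differentiableAt (hWo.mem_nhds hs)
  have a2 := hd2.differentiableAt (hWo.mem_nhds hs)
  have hne : t0 s * t2 s ≠ 0 := mul_ne_zero hn0 hn2
  ext v
  rw [fderiv_eq_sum_pd, zero_apply]
  refine Finset.sum_eq_zero fun j _ => ?_
  obtain ⟨aZ, hZ⟩ := hsol.pd_todaZ hWo hWc hs j
  have hdiff : DifferentiableAt ℂ
      (fun t => todaZ k (q t) (p t) * t1 t ^ 2 * (t0 t * t2 t)⁻¹) s :=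
    (aZ.fun_mul (a1.fun_pow 2)).fun_mul ((a0.fun_mul a2).fun_inv hne)
  obtain ⟨e, he⟩ : ∃ e : Fin N → ℂ, e = Pi.single j 1 := ⟨_, rfl⟩
  have line : ∀ f : (Fin N → ℂ) → ℂ, DifferentiableAt ℂ f s →
      HasDerivAt (fun t : ℂ => f (s + t • e)) (pd j f s) 0 := fun f hf => by
    rw [he]; exact hasDerivAt_line hf _
  have b := (((line _ aZ).fun_mul ((line _ a1).fun_pow 2)).fun_mul
    (((line _ a0).fun_mul (line _ a2)).fun_inv (by simpa using hne)))
  have c := (line _ hdiff).unique b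
  simp only [zero_smul, add_zero] at c
  rw [c]
  have hl1 := ham_of_mem_l hs' hx j
  have hl2 := ham_of_mem_l hs' hz j
  obtain ⟨_, hZ'⟩ := todaZ_of_mem_l hx
  have hZ'' := hZ' j
  simp only at hZ''
  rw [← hZ] at hZ''
  rw [← h0] at hl1
  rw [← h2] at hl2
  have hl0 : State.ham ⟨k, q s, p s⟩ j s = pd j t1 s / t1 s := (h1 j).symm
  rw [hl0] at hl1 hl2
  have hsj := config.ne_zero hs' j
  -- All logarithmic derivatives are written through that of t1 and the products q_j p_j at x and at
  -- the current point. In the quotient they cancel.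
  have eZ : pd j (fun t => todaZ k (q t) (p t)) s
      = (x.q j * x.p j - q s j * p s j) / s j * todaZ k (q s) (p s) := by
    field_simp
    linear_combination -hZ''
  have e0 : pd j t0 s = (pd j t1 s / t1 s + x.q j * x.p j / s j) * t0 s := by
    rw [hl1]; field_simp; ring
  have e2 : pd j t2 s = (pd j t1 s / t1 s - q s j * p s j / s j) * t2 s := by
    rw [← hl2]; field_simp
  rw [eZ, e0, e2]
  field_simp
  ring

/-- α is unchanged by l^n since κ₀ + κ₁ is. So a_n is the constant required by `along_alongLog` at
the translated parameters. -/
theorem expo_eq (k : Params N) (n : ℤ) :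
    expo k n = -(k.k1 - n) * ((k.k0 + n) - 1)
      + ({ k with k0 := k.k0 + n, k1 := k.k1 - n } : Params N).alpha
        * (({ k with k0 := k.k0 + n, k1 := k.k1 - n } : Params N).alpha + k.kinf) := by
  have ha : ({ k with k0 := k.k0 + n, k1 := k.k1 - n } : Params N).alpha = k.alpha := by
    simp only [Params.alpha]; ring
  rw [ha, expo]

/-- a_n is quadratic in n with leading coefficient 1. Its second difference 2 is the power of ψ in
XY log τ_n = ψ² Z. -/
theorem expo_sub_one_add_expo_add_one (k : Params N) (n : ℤ) :
    expo k (n - 1) + expo k (n + 1) = 1 + 1 + expo k n + expo k n := by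
  simp only [expo]
  push_cast
  ring

/-- The Toda equation at one value of `n`. -/
theorem toda_equation (hN : 2 ≤ N) {k : Params N} {D : Set (Fin N → ℂ)} (hD : D ⊆ config N)
    {q p : (Fin N → ℂ) → Fin N → ℂ} (hqp : IsSolution k D q p) {W : ℤ → Set (Fin N → ℂ)}
    (hWo : ∀ n, IsOpen (W n)) (hWD : ∀ n, W n ⊆ D) {n : ℤ}
    (hWc : IsPreconnected (W (n - 1) ∩ W n ∩ W (n + 1)))
    {ltau : ℤ → (Fin N → ℂ) → ℂ} (hltau : ∀ n, IsTau k q p n (W n) (ltau n))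
    {L : (Fin N → ℂ) → ℂ} (hlog : IsLogDelta (sOf ⁻¹' D) L) :
    ∃ c : ℂ, c ≠ 0 ∧ ∀ xi ∈ sOf ⁻¹' (W (n - 1) ∩ W n ∩ W (n + 1)),
      along (vecX L) (alongLog (vecY L) (tauSeq k L ltau n)) xi
        = c * (tauSeq k L ltau (n - 1) xi * tauSeq k L ltau (n + 1) xi)
          / tauSeq k L ltau n xi ^ 2 := by
  -- A base point is needed to identify the parameters k' of the transformed solution and to see
  -- that the constant is not zero. On an empty set any constant will do.
  rcases Set.eq_empty_or_nonempty (W (n - 1) ∩ W n ∩ W (n + 1)) with hemp | ⟨s₀, hs₀⟩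
  · exact ⟨1, one_ne_zero, fun xi hxi => by rw [hemp] at hxi; exact hxi.elim⟩
  set V := W (n - 1) ∩ W n ∩ W (n + 1) with hV
  have hVo : IsOpen V := ((hWo _).inter (hWo _)).inter (hWo _)
  have hWc' := fun m => (hWD m).trans hD
  have hV0 : V ⊆ W (n - 1) := fun s hs => hs.1.1
  have hV1 : V ⊆ W n := fun s hs => hs.1.2
  have hV2 : V ⊆ W (n + 1) := fun s hs => hs.2
  have hVc : V ⊆ config N := hV1.trans (hWc' n)
  obtain ⟨k', q', p', hsol, hmem⟩ := preservesSolutions_lPow n (W n) (hWo n) (hWc' n) k q p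
    (hqp.mono (hWD n)) fun s hs => by
      obtain ⟨y, hy, _⟩ := (hltau n).dlog s hs
      exact Part.dom_iff_mem.2 ⟨y, hy⟩
  have hk' : k' = { k with k0 := k.k0 + n, k1 := k.k1 - n } :=
    par_of_mem_lPow n (hmem s₀ (hV1 hs₀))
  have hdlog : ∀ s ∈ W n, ∀ i, pd i (ltau n) s / ltau n s = ham k' i (q' s) (p' s) s := by
    intro s hs
    obtain ⟨y, hy, hy'⟩ := (hltau n).dlog s hs
    rw [Part.mem_unique hy (hmem s hs)] at hy'
    exact hy'
  have hsolV := hsol.mono hV1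
  have hprev : ∀ s ∈ V, ∃ x : State N, (⟨k', q' s, p' s⟩ : State N) ∈ l s x ∧
      ∀ i, pd i (ltau (n - 1)) s / ltau (n - 1) s = x.ham i s := by
    intro s hs
    obtain ⟨x, hx, hx'⟩ := (hltau (n - 1)).dlog s (hV0 hs)
    refine ⟨x, mem_l_of_mem_lPow hx ?_, hx'⟩
    rw [sub_add_cancel]
    exact hmem s (hV1 hs)
  have hnext : ∀ s ∈ V, ∃ z : State N, z ∈ l s ⟨k', q' s, p' s⟩ ∧
      ∀ i, pd i (ltau (n + 1)) s / ltau (n + 1) s = z.ham i s := by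
    intro s hs
    obtain ⟨z, hz, hz'⟩ := (hltau (n + 1)).dlog s (hV2 hs)
    exact ⟨z, mem_l_of_mem_lPow (hmem s (hV1 hs)) hz, hz'⟩
  have hn0 : ∀ s ∈ V, ltau (n - 1) s ≠ 0 := fun s hs => (hltau _).ne_zero s (hV0 hs)
  have hn1 : ∀ s ∈ V, ltau n s ≠ 0 := fun s hs => (hltau _).ne_zero s (hV1 hs)
  have hn2 : ∀ s ∈ V, ltau (n + 1) s ≠ 0 := fun s hs => (hltau _).ne_zero s (hV2 hs)
  have hd0 := (hltau (n - 1)).diff.mono hV0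
  have hd1 := (hltau n).diff.mono hV1
  have hd2 := (hltau (n + 1)).diff.mono hV2
  have hZd : DifferentiableOn ℂ (fun t => todaZ k' (q' t) (p' t)) V := by
    intro s hs
    obtain ⟨j⟩ : Nonempty (Fin N) := ⟨⟨0, by omega⟩⟩
    exact (hsolV.pd_todaZ hVo hVc hs j).1.differentiableWithinAt
  obtain ⟨c, hc⟩ := hVo.exists_is_const_of_fderiv_eq_zero (𝕜 := ℂ) hWc
    (f := fun t => todaZ k' (q' t) (p' t) * ltau n t ^ 2 * (ltau (n - 1) t * ltau (n + 1) t)⁻¹)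
    ((hZd.fun_mul (hd1.fun_pow 2)).fun_mul ((hd0.fun_mul hd2).fun_inv
      fun s hs => mul_ne_zero (hn0 s hs) (hn2 s hs))) (by
      intro s hs
      obtain ⟨x, hx, hx'⟩ := hprev s hs
      obtain ⟨z, hz, hz'⟩ := hnext s hs
      exact fderiv_toda_quotient hVo hVc hsolV hd0 hd1 hd2 hs hx hz (hn0 s hs) (hn1 s hs)
        (hn2 s hs) hx' (hdlog s (hV1 hs)) hz')
  refine ⟨c, ?_, fun xi hxi => ?_⟩
  -- The constant is Z l^n(τ)² / (l^{n-1}(τ) l^{n+1}(τ)) at the base point, and Z ≠ 0 there because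
  -- the state is an image under l.
  · rw [← hc s₀ hs₀]
    obtain ⟨x, hx, _⟩ := hprev s₀ hs₀
    exact mul_ne_zero (mul_ne_zero (todaZ_of_mem_l hx).1 (pow_ne_zero 2 (hn1 s₀ hs₀)))
      (inv_ne_zero (mul_ne_zero (hn0 s₀ hs₀) (hn2 s₀ hs₀)))
  · have hs : sOf xi ∈ V := hxi
    have hXY := along_alongLog hN (hWo n) (hWD n) (hWc' n) hlog hsol (hltau n).diff
      (hltau n).ne_zero hdlog (a := expo k n) (by rw [hk']; exact expo_eq k n) (hV1 hs)
    change along (vecX L) (alongLog (vecY L) (tauSeq k L ltau n)) xi = _ at hXY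
    rw [hXY, ← hc _ hs]
    have e0 := hn0 _ hs
    have e1 := hn1 _ hs
    have e2 := hn2 _ hs
    have eψ : psiPow L (expo k (n - 1)) xi * psiPow L (expo k (n + 1)) xi
        = psi L xi ^ 2 * psiPow L (expo k n) xi ^ 2 := by
      rw [← psiPow_add, expo_sub_one_add_expo_add_one, psiPow_add, psiPow_add, psiPow_add, psi]
      ring
    have e3 := psiPow_ne_zero L (expo k n) xi
    simp only [tauSeq]
    rw [mul_mul_mul_comm (psiPow L (expo k (n - 1)) xi), eψ]
    field_simp

end Garnier

theorem theorem2p2 (N : ℕ) (hN : 2 ≤ N) (k : Garnier.Params N)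
    (D : Set (Fin N → ℂ)) (hDo : IsOpen D) (hD : D ⊆ Garnier.config N)
    (q p : (Fin N → ℂ) → Fin N → ℂ) (hqp : Garnier.IsSolution k D q p)
    (W : ℤ → Set (Fin N → ℂ)) (hWo : ∀ n, IsOpen (W n)) (hWD : ∀ n, W n ⊆ D)
    (hWc : ∀ n, IsPreconnected (W (n - 1) ∩ W n ∩ W (n + 1)))
    (ltau : ℤ → (Fin N → ℂ) → ℂ) (hltau : ∀ n, Garnier.IsTau k q p n (W n) (ltau n))
    (logDelta : (Fin N → ℂ) → ℂ) (hlog : Garnier.IsLogDelta (Garnier.sOf ⁻¹' D) logDelta) :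
    (∀ xi ∈ Garnier.sOf ⁻¹' D,
      VectorField.lieBracket ℂ (Garnier.vecX logDelta) (Garnier.vecY logDelta) xi = 0) ∧
    ∃ c : ℤ → ℂ, ∀ n, c n ≠ 0 ∧
      ∀ xi ∈ Garnier.sOf ⁻¹' (W (n - 1) ∩ W n ∩ W (n + 1)),
        Garnier.along (Garnier.vecX logDelta)
            (Garnier.alongLog (Garnier.vecY logDelta) (Garnier.tauSeq k logDelta ltau n)) xi
          = c n * (Garnier.tauSeq k logDelta ltau (n - 1) xi
              * Garnier.tauSeq k logDelta ltau (n + 1) xi)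
            / Garnier.tauSeq k logDelta ltau n xi ^ 2 := by
  refine ⟨fun xi hxi => Garnier.lieBracket_vecX_vecY hN hlog
    (Garnier.preimage_sOf_mem_nhds hDo hD hxi), ?_⟩
  choose c hc using fun n => Garnier.toda_equation hN hD hqp hWo hWD (hWc n) hltau hlog
  exact ⟨c, hc⟩
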